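/- Let $A$ be a Noetherian local ring with maximal ideal $\mathfrak m$ and dimension $d$. Write $\ell$ for length, and let $e(A)=\lim_{n\to\infty} d!\,\ell(A/\mathfrak m^n)/n^d$ be the multiplicity of $A$ (the limit exists and is a natural number). The parameter degree $\mathrm{pd}(A)$ of $A$ is the least length of $A/I$, where $I$ runs over all parameter ideals, i.e. ideals generated by $d$ elements whose radical is $\mathfrak m$. The Noether Normalization degree $N(A)$ of $A$ is the least value of $\mu_S(A)$, the minimal number of generators of $A$ as an $S$-module, where $S$ runs over all regular subrings of $A$ over which $A$ is finite; $N(A)=\infty$ if there is no such $S$. Then $$e(A)\le \mathrm{pd}(A)\le N(A).$$ Moreover, suppose that $A$ is ($\mathfrak m$-adically) complete. If $e(A)=\mathrm{pd}(A)$, then $A$ is Cohen–Macaulay. If the residue field $A/\mathfrak m$ is infinite, then $e(A)=\mathrm{pd}(A)$ if and only if $A$ is Cohen–Macaulay. -/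

import Mathlib

open IsLocalRing Filter Topology

/-- `e` is the multiplicity of the Noetherian local ring `A` with maximal ideal `m` and
dimension `d`: it is the limit of `d! * length (A / m ^ n) / n ^ d` as `n` tends to infinity.
(The lengths involved are all finite, so that `ENat.toNat` loses nothing.) -/
def IsLocalMultiplicity (A : Type*) [CommRing A] [IsLocalRing A] (e : ℕ) : Prop :=
  ∃ d : ℕ, ringKrullDim A = (d : WithBot ℕ∞) ∧
    Tendsto (fun n : ℕ =>
        ((d.factorial : ℝ) * ((Module.length A (A ⧸ maximalIdeal A ^ n)).toNat : ℝ)) / (n : ℝ) ^ d)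
      atTop (𝓝 (e : ℝ))

/-- A parameter ideal of a local ring `A` of dimension `d`: an ideal generated by a system of
parameters, that is, by `d` elements which generate an ideal whose radical is the maximal ideal. -/
def IsParameterIdeal {A : Type*} [CommRing A] [IsLocalRing A] (I : Ideal A) : Prop :=
  ∃ d : ℕ, ringKrullDim A = (d : WithBot ℕ∞) ∧
    ∃ x : Fin d → A, I = Ideal.span (Set.range x) ∧ I.radical = maximalIdeal A

/-- The parameter degree: the least length of `A / I`, for `I` a parameter ideal. -/
noncomputable def parameterDegree (A : Type*) [CommRing A] [IsLocalRing A] : ℕ∞ :=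
  ⨅ (I : Ideal A) (_ : IsParameterIdeal I), Module.length A (A ⧸ I)

/-- The Noether Normalization degree: the least value of the minimal number of generators of `A`
as an `S`-module, for `S` a regular subring of `A` over which `A` is finite; it is `⊤` if there is
no such subring. -/
noncomputable def noetherNormalizationDegree (A : Type*) [CommRing A] : ℕ∞ :=
  ⨅ (S : Subring A) (_ : IsRegularRing S) (_ : Module.Finite S A),
    ((⊤ : Submodule S A).spanFinrank : ℕ∞)

/-- The depth of a local ring: the supremum of the lengths of the `A`-regular sequences.
(Over a local ring, `IsRegular` forces the elements to lie in the maximal ideal.) -/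
noncomputable def localDepth (A : Type*) [CommRing A] [IsLocalRing A] : ℕ∞ :=
  ⨆ (rs : List A) (_ : RingTheory.Sequence.IsRegular A rs), (rs.length : ℕ∞)

/-- A (Noetherian) local ring is Cohen–Macaulay if its depth equals its dimension. -/
def IsCohenMacaulayLocalRing (A : Type*) [CommRing A] [IsLocalRing A] : Prop :=
  ((localDepth A : ℕ∞) : WithBot ℕ∞) = ringKrullDim A

/-! ### Additivity of length. -/

section Length

variable {R M M' : Type*} [Ring R] [AddCommGroup M] [Module R M] [AddCommGroup M'] [Module R M']

/-! Lower bound. Let `I = (x_1, ..., x_d)` be a parameter ideal. Adjoining to `I ^ n` the monomials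
of degree less than `n`, lexicographically largest first, filters `A / I ^ n` with cyclic factors `A
/ C`, one for each monomial. Each `C` contains `I`, because multiplying a monomial by some `x_j`
makes it lexicographically larger. Hence `ℓ(A / 𝔪 ^ n) ≤ ℓ(A / I ^ n) ≤ ℓ(A / I) * #monomials`, and
the count grows like `n ^ d / d!`. With the eventual polynomiality of `ℓ(A / 𝔪 ^ n)`
(`fwdDiffEventuallyZero_filtration`), this gives both the existence of `e` and `e ≤ ℓ(A / I)`.

Equality. If a single `C` could be strictly larger than `I` independently of `n`, the same would
hold at all multiples of its monomial, a set of full asymptotic density, and `e + 1 ≤ ℓ(A / I)`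
(`colength_pow_add_card_filter_le`). So `e = ℓ(A / I)` excludes every such defect, and an induction
along the lexicographic well-order with Krull's intersection theorem (`mem_lexIdealGE`) makes `x_1,
..., x_d` a regular sequence.

Upper bound. For a regular `S` the ideal `𝔪_S A` is a parameter ideal, and `A / 𝔪_S A` has length at
most `μ_S(A)` (`parameterDegree_le_spanFinrank`).

Converse. For an infinite residue field and `A` Cohen–Macaulay, a regular superficial `x`
(`exists_superficial`) preserves the multiplicity in `A / (x)`, which is again Cohen–Macaulay by
`HasDepthGE.exchange`. Induction on `d` ends in dimension zero, where `e = ℓ(A)`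
(`parameterDegree_le_of_hasDepthGE`). -/

theorem Module.length_eq_length_add_length_quotient (N : Submodule R M) :
    Module.length R M = Module.length R N + Module.length R (M ⧸ N) :=
  Module.length_eq_add_of_exact N.subtype N.mkQ N.injective_subtype N.mkQ_surjective
    (LinearMap.exact_subtype_mkQ N)

theorem Module.length_quotient_eq_add_of_le {N P : Submodule R M} (h : N ≤ P) :
    Module.length R (M ⧸ N) =
      Module.length R (P.map N.mkQ) + Module.length R (M ⧸ P) := by
  rw [Module.length_eq_length_add_length_quotient (P.map N.mkQ),
    (Submodule.quotientQuotientEquivQuotient N P h).length_eq]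

theorem Module.length_quotient_anti {N P : Submodule R M} (h : N ≤ P) :
    Module.length R (M ⧸ P) ≤ Module.length R (M ⧸ N) := by
  rw [Module.length_quotient_eq_add_of_le h]
  exact le_add_self

/-- The map `φ` induces an isomorphism from `P / (P ⊓ φ⁻¹ N)` onto `(N ⊔ φ P) / N`. The four-term
form avoids subtracting possibly infinite lengths. -/
theorem Module.length_quotient_ker_add (φ : M →ₗ[R] M') (N : Submodule R M') (P : Submodule R M) :
    Module.length R (M' ⧸ N) + Module.length R (M ⧸ P) =
      Module.length R (M' ⧸ (N ⊔ P.map φ)) + Module.length R (M ⧸ (P ⊓ N.comap φ)) := by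
  have e : Module.length R ((N ⊔ P.map φ).map N.mkQ) =
      Module.length R (P.map (P ⊓ N.comap φ).mkQ) := by
    let f : P →ₗ[R] (M' ⧸ N) := (N.mkQ ∘ₗ φ) ∘ₗ P.subtype
    let g : P →ₗ[R] (M ⧸ (P ⊓ N.comap φ)) := (P ⊓ N.comap φ).mkQ ∘ₗ P.subtype
    have hf : LinearMap.range f = (N ⊔ P.map φ).map N.mkQ := by
      rw [LinearMap.range_comp, Submodule.range_subtype, Submodule.map_sup, Submodule.map_comp]
      simp
    have hg : LinearMap.range g = P.map (P ⊓ N.comap φ).mkQ := by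
      rw [LinearMap.range_comp, Submodule.range_subtype]
    have hk : LinearMap.ker f = LinearMap.ker g := by
      ext a
      simp [f, g]
    rw [← hf, ← hg, ← f.quotKerEquivRange.length_eq, ← g.quotKerEquivRange.length_eq, hk]
  rw [Module.length_quotient_eq_add_of_le (le_sup_left : N ≤ N ⊔ P.map φ),
    Module.length_quotient_eq_add_of_le (inf_le_left : P ⊓ N.comap φ ≤ P), e]
  ring

end Length

/-! ### Colengths of ideals containing a power of the maximal ideal. -/

section Colength

variable {A : Type*} [CommRing A]

/-- The length of `A ⧸ J`, with value `0` if it is infinite. -/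
noncomputable def Ideal.colength (J : Ideal A) : ℕ := (Module.length A (A ⧸ J)).toNat

theorem mem_map_mulLeft_top {x a : A} :
    a ∈ Submodule.map (LinearMap.mulLeft A x) (⊤ : Ideal A) ↔ a ∈ Ideal.span {x} := by
  simp only [Submodule.mem_map, Submodule.mem_top, true_and, LinearMap.mulLeft_apply,
    Ideal.mem_span_singleton', mul_comm x]

variable [IsLocalRing A] [IsNoetherianRing A]

theorem length_quotient_ne_top_of_pow_le {J : Ideal A} {n : ℕ} (h : maximalIdeal A ^ n ≤ J) :
    Module.length A (A ⧸ J) ≠ ⊤ := by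
  by_cases hJ : J = ⊤
  · subst hJ
    have : Subsingleton (A ⧸ (⊤ : Ideal A)) := Ideal.Quotient.subsingleton_iff.mpr rfl
    simp [Module.length_eq_zero]
  have hm : maximalIdeal A ∈ J.minimalPrimes := by
    refine ⟨⟨inferInstance, le_maximalIdeal hJ⟩, fun q hq _ => ?_⟩
    have := hq.1
    exact Ideal.IsPrime.le_of_pow_le (h.trans hq.2)
  have := IsLocalRing.quotient_artinian_of_mem_minimalPrimes_of_isLocalRing J hm
  rw [Module.length_eq_of_surjective (R := A ⧸ J) Ideal.Quotient.mk_surjective]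
  exact Module.length_ne_top

theorem coe_colength {J : Ideal A} {n : ℕ} (h : maximalIdeal A ^ n ≤ J) :
    (J.colength : ℕ∞) = Module.length A (A ⧸ J) :=
  ENat.natCast_toNat (length_quotient_ne_top_of_pow_le h)

theorem colength_anti {J K : Ideal A} {n : ℕ} (h : maximalIdeal A ^ n ≤ J) (hJK : J ≤ K) :
    K.colength ≤ J.colength := by
  have := Module.length_quotient_anti (R := A) hJK
  rw [← coe_colength h, ← coe_colength (h.trans hJK)] at this
  exact_mod_cast this

theorem colength_add_colength (x : A) {N P : Ideal A} {n : ℕ} (hN : maximalIdeal A ^ n ≤ N)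
    (hP : maximalIdeal A ^ n ≤ P) :
    N.colength + P.colength = (N ⊔ Submodule.map (LinearMap.mulLeft A x) P : Ideal A).colength +
      (P ⊓ Submodule.comap (LinearMap.mulLeft A x) N : Ideal A).colength := by
  have := Module.length_quotient_ker_add (LinearMap.mulLeft A x) N P
  rw [← coe_colength hN, ← coe_colength hP,
    ← coe_colength (n := n) (J := N ⊔ Submodule.map (LinearMap.mulLeft A x) P) (hN.trans le_sup_left),
    ← coe_colength (n := n) (J := P ⊓ Submodule.comap (LinearMap.mulLeft A x) N)
      (le_inf hP (hN.trans fun a ha => N.mul_mem_left x ha))] at this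
  exact_mod_cast this

theorem colength_eq_add_colength_comap (x : A) {N : Ideal A} {n : ℕ}
    (hN : maximalIdeal A ^ n ≤ N) :
    N.colength = (N ⊔ Ideal.span {x}).colength +
      Ideal.colength (Submodule.comap (LinearMap.mulLeft A x) N) := by
  have h := colength_add_colength x hN le_top
  have h0 : (⊤ : Ideal A).colength = 0 := by
    have : Subsingleton (A ⧸ (⊤ : Ideal A)) := Ideal.Quotient.subsingleton_iff.mpr rfl
    simp [Ideal.colength, Module.length_eq_zero]
  have e : Submodule.map (LinearMap.mulLeft A x) (⊤ : Ideal A) = Ideal.span {x} :=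
    Submodule.ext fun a => mem_map_mulLeft_top
  rwa [h0, e, top_inf_eq] at h

end Colength

/-! ### Eventually vanishing differences. -/

section ForwardDiff

/-- The `r`-th forward differences of `f` eventually vanish. -/
def FwdDiffEventuallyZero (r : ℕ) (f : ℕ → ℤ) : Prop :=
  ∀ᶠ n in atTop, (fwdDiff 1)^[r] f n = 0

theorem FwdDiffEventuallyZero.sub {r : ℕ} {f g : ℕ → ℤ} (hf : FwdDiffEventuallyZero r f)
    (hg : FwdDiffEventuallyZero r g) : FwdDiffEventuallyZero r (f - g) := by
  filter_upwards [hf, hg] with n h1 h2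
  rw [sub_eq_add_neg, fwdDiff_iter_add, ← neg_one_smul ℤ g, fwdDiff_iter_const_smul]
  simp [h1, h2]

theorem FwdDiffEventuallyZero.shift {r : ℕ} {f : ℕ → ℤ} (hf : FwdDiffEventuallyZero r f) :
    FwdDiffEventuallyZero r (fun n => f (n + 1)) := by
  filter_upwards [(tendsto_add_atTop_nat 1).eventually hf] with n h
  rw [fwdDiff_iter_comp_add]
  exact h

theorem FwdDiffEventuallyZero.succ_iff {r : ℕ} {f : ℕ → ℤ} :
    FwdDiffEventuallyZero (r + 1) f ↔ FwdDiffEventuallyZero r (fun n => f (n + 1) - f n) :=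
  Iff.rfl

end ForwardDiff

/-! ### Eventual polynomiality of the Hilbert–Samuel function. -/

section HilbertFunction

variable {A : Type*} [CommRing A] [IsLocalRing A] [IsNoetherianRing A]

local notation "𝔪" => maximalIdeal A

/-- This is Hilbert's theorem for the graded module with pieces `P_n / N_n`, whose lengths are the
differences of colengths. The set `s` contains the generators of `𝔪` that may act nontrivially. For
`x ∈ s`, the kernel and cokernel of multiplication by `x` are again of this shape and are killed by
`x`, so `x` can be dropped from `s`. -/
theorem fwdDiffEventuallyZero_filtration {T : Set A} (hT : Ideal.span T = 𝔪) (s : Finset A)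
    (hs : ∀ x ∈ s, x ∈ 𝔪) :
    ∀ N P : Ideal.Filtration 𝔪 A, (∀ n, 𝔪 ^ (n + 1) ≤ N.N n) → (∀ n, N.N n ≤ P.N n) →
    (∀ n, P.N n ≤ 𝔪 ^ n) →
    (∀ x ∈ T, x ∉ s → ∀ n, (P.N n).map (LinearMap.mulLeft A x) ≤ N.N (n + 1)) →
    FwdDiffEventuallyZero s.card
      (fun n => (Ideal.colength (N.N n) : ℤ) - Ideal.colength (P.N n)) := by
  classical
  induction s using Finset.induction_on with
  | empty =>
    intro N P hN hNP hP hx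
    -- A filtration contained in the `𝔪`-adic one is stable, so eventually `P_{n+1} = 𝔪 P_n`. Since
    -- every generator sends `P_n` into `N_{n+1}`, the graded pieces vanish.
    have hst : P.Stable := by
      refine (Ideal.stableFiltration_stable 𝔪 (⊤ : Submodule A A)).of_le fun n => ?_
      simpa using hP n
    obtain ⟨n₀, h₀⟩ := hst
    filter_upwards [eventually_ge_atTop (n₀ + 1)] with n hn
    obtain ⟨n, rfl⟩ : ∃ k, n = k + 1 := ⟨n - 1, by lia⟩
    have : N.N (n + 1) = P.N (n + 1) := by
      refine le_antisymm (hNP _) ?_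
      rw [← h₀ n (by lia)]
      refine Submodule.smul_le.mpr fun r hr p hp => ?_
      rw [← hT] at hr
      induction hr using Submodule.span_induction with
      | mem x hx' => exact hx x hx' (by simp) n ⟨p, hp, rfl⟩
      | zero => simp
      | add r r' _ _ h h' => exact add_smul r r' p ▸ add_mem h h'
      | smul b r _ h => exact smul_assoc b r p ▸ Submodule.smul_mem _ b h
    simp [this]
  | insert x s hxs ih =>
    intro N P hN hNP hP hx
    have hxm : x ∈ 𝔪 := hs x (by simp)
    have hxP : ∀ n, (P.N n).map (LinearMap.mulLeft A x) ≤ P.N (n + 1) := by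
      rintro n _ ⟨a, ha, rfl⟩
      exact P.smul_le n (Submodule.smul_mem_smul hxm ha)
    -- `P / N'` is the cokernel and `K / N` the kernel of multiplication by `x`. The truncated `n -
    -- 1` at `n = 0` is harmless: only the shift of `N'` by one enters below.
    let N' : Ideal.Filtration 𝔪 A :=
      { N := fun n => N.N n ⊔ (P.N (n - 1)).map (LinearMap.mulLeft A x)
        mono := fun n => sup_le_sup (N.mono n) (Submodule.map_mono (P.antitone (by lia)))
        smul_le := fun n => by
          rw [Submodule.smul_sup]
          refine sup_le_sup (N.smul_le n) ?_
          rw [← Submodule.map_smul'']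
          refine Submodule.map_mono ?_
          rcases n with _ | n
          · exact Submodule.smul_le_right
          · exact P.smul_le n }
    let K : Ideal.Filtration 𝔪 A :=
      { N := fun n => P.N n ⊓ (N.N (n + 1)).comap (LinearMap.mulLeft A x)
        mono := fun n => inf_le_inf (P.mono n) (Submodule.comap_mono (N.mono _))
        smul_le := fun n => by
          refine le_inf ((smul_mono_right _ inf_le_left).trans (P.smul_le n)) ?_
          refine (smul_mono_right _ inf_le_right).trans ?_
          refine Submodule.smul_le.mpr fun r hr a ha => ?_
          have : r • (x * a) ∈ N.N (n + 2) := N.smul_le (n + 1) (Submodule.smul_mem_smul hr ha)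
          simpa [mul_left_comm] using this }
    have hs' : ∀ y ∈ s, y ∈ 𝔪 := fun y hy => hs y (by simp [hy])
    have hN' := ih hs' N' P (fun n => (hN n).trans le_sup_left)
      (fun n => sup_le (hNP n) (by
        rcases n with _ | n
        · rintro _ ⟨a, ha, rfl⟩
          exact (P.N 0).smul_mem x ha
        · exact hxP n)) hP
      (fun y hy hys n => by
        by_cases hyx : y = x
        · subst hyx
          exact le_sup_right
        · exact (hx y hy (by simp [hyx, hys]) n).trans le_sup_left)
    have hNK : ∀ n, N.N n ≤ K.N n := fun n => le_inf (hNP n) fun a ha =>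
      N.smul_le n (Submodule.smul_mem_smul hxm ha)
    have hK := ih hs' N K hN hNK (fun n => inf_le_left.trans (hP n))
      (fun y hy hys n => by
        by_cases hyx : y = x
        · subst hyx
          rintro _ ⟨a, ha, rfl⟩
          exact ha.2
        · exact (Submodule.map_mono inf_le_left).trans (hx y hy (by simp [hyx, hys]) n))
    rw [Finset.card_insert_of_notMem hxs, FwdDiffEventuallyZero.succ_iff]
    convert hN'.shift.sub hK using 1
    funext n
    have hle : 𝔪 ^ (n + 2) ≤ P.N n := by
      refine le_trans (Ideal.pow_le_pow_right (by lia)) ((hN n).trans (hNP n))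
    have := colength_add_colength x (hN (n + 1)) hle
    simp only [Pi.sub_apply, N', K, Nat.add_sub_cancel]
    lia

theorem exists_fwdDiffEventuallyZero_colength_pow (A : Type*) [CommRing A] [IsLocalRing A]
    [IsNoetherianRing A] :
    ∃ r, FwdDiffEventuallyZero r (fun n => ((maximalIdeal A ^ n).colength : ℤ)) := by
  obtain ⟨s, hs⟩ := IsNoetherian.noetherian (maximalIdeal A)
  refine ⟨s.card + 1, FwdDiffEventuallyZero.succ_iff.mpr ?_⟩
  let F := (maximalIdeal A).stableFiltration (⊤ : Submodule A A)
  let F' : (maximalIdeal A).Filtration A :=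
    { N := fun n => F.N (n + 1), mono := fun n => F.mono _, smul_le := fun n => F.smul_le _ }
  have h := fwdDiffEventuallyZero_filtration (T := (s : Set A)) hs s
    (fun x hx => hs ▸ Submodule.subset_span hx) F' F (fun n => by simp [F', F])
    (fun n => F.mono n) (fun n => by simp [F]) (fun x hx hxs => absurd hx hxs)
  have e : ∀ n, F.N n = maximalIdeal A ^ n := fun n => by simp [F]
  simpa only [F', e, sub_self] using h

end HilbertFunction

/-! ### Growth of functions with eventually constant differences. -/

section Asymptotics

theorem fwdDiff_iter_eq_zero_of_forall_ge {g : ℕ → ℤ} {N : ℕ} (hg : ∀ n ≥ N, g n = 0) (j : ℕ) :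
    ∀ n ≥ N, (fwdDiff 1)^[j] g n = 0 := by
  induction j with
  | zero => exact hg
  | succ j ih =>
    intro n hn
    rw [Function.iterate_succ_apply', fwdDiff, ih n hn, ih (n + 1) (by lia), sub_zero]

theorem eventually_eq_of_eventually_fwdDiff_eq_zero {g : ℕ → ℤ}
    (hg : ∀ᶠ n in atTop, fwdDiff 1 g n = 0) : ∃ c, ∀ᶠ n in atTop, g n = c := by
  obtain ⟨N, hN⟩ := eventually_atTop.mp hg
  refine ⟨g N, eventually_atTop.mpr ⟨N, fun n hn => ?_⟩⟩
  induction n, hn using Nat.le_induction with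
  | base => rfl
  | succ n hn ih => rw [← ih]; exact sub_eq_zero.mp (hN n hn)

theorem tendsto_pow_div_add_pow (d N : ℕ) :
    Tendsto (fun n : ℕ => (n : ℝ) ^ d / ((n + N : ℕ) : ℝ) ^ d) atTop (𝓝 1) := by
  have h := (tendsto_natCast_div_add_atTop (𝕜 := ℝ) (N : ℝ)).pow d
  simpa [div_pow] using h

theorem tendsto_choose_div_pow (d : ℕ) :
    Tendsto (fun n : ℕ => (n.choose d : ℝ) / (n : ℝ) ^ d) atTop (𝓝 (1 / d.factorial)) := by
  have h1 : Asymptotics.IsEquivalent atTop (fun n : ℕ => (n.choose d : ℝ) / (n : ℝ) ^ d)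
      (fun n : ℕ => ((n : ℝ) ^ d / d.factorial) / (n : ℝ) ^ d) :=
    (isEquivalent_choose d).div Asymptotics.IsEquivalent.refl
  refine (h1.symm.tendsto_nhds_iff).mp ?_
  refine tendsto_const_nhds.congr' ?_
  filter_upwards [eventually_gt_atTop 0] with n hn
  have : (n : ℝ) ≠ 0 := by positivity
  field_simp

theorem tendsto_choose_div_pow_of_lt {k d : ℕ} (h : k < d) :
    Tendsto (fun n : ℕ => (n.choose k : ℝ) / (n : ℝ) ^ d) atTop (𝓝 0) := by
  have h1 : Tendsto (fun n : ℕ => ((n : ℝ) ^ (d - k))⁻¹) atTop (𝓝 0) :=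
    tendsto_inv_atTop_zero.comp
      ((tendsto_pow_atTop (by lia)).comp tendsto_natCast_atTop_atTop)
  have h2 := (tendsto_choose_div_pow k).mul h1
  rw [mul_zero] at h2
  refine h2.congr fun n => ?_
  rw [← div_eq_mul_inv, div_div, ← pow_add, Nat.add_sub_cancel' h.le]

/-- Newton's formula based at a large `N` writes `f (n + N)` as a combination of `n.choose k` for `k
≤ d`. The leading coefficient is `c`. -/
theorem tendsto_of_eventually_fwdDiff_eq {f : ℕ → ℤ} {d : ℕ} {c : ℤ}
    (h : ∀ᶠ n in atTop, (fwdDiff 1)^[d] f n = c) :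
    Tendsto (fun n : ℕ => ((d.factorial : ℝ) * (f n : ℝ)) / (n : ℝ) ^ d) atTop (𝓝 (c : ℝ)) := by
  obtain ⟨N, hN⟩ := eventually_atTop.mp h
  have hz : ∀ n ≥ N, (fwdDiff 1)^[d + 1] f n = 0 := fun n hn => by
    rw [Function.iterate_succ_apply', fwdDiff, hN n hn, hN (n + 1) (by lia), sub_self]
  have hz' : ∀ k, d < k → (fwdDiff 1)^[k] f N = 0 := fun k hk => by
    obtain ⟨j, rfl⟩ := Nat.exists_eq_add_of_le hk
    have := fwdDiff_iter_eq_zero_of_forall_ge hz j N le_rfl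
    rwa [← Function.iterate_add_apply, add_comm j] at this
  have key : ∀ n ≥ d, f (n + N) =
      ∑ k ∈ Finset.range (d + 1), (n.choose k : ℤ) * (fwdDiff 1)^[k] f N := by
    intro n hn
    have := shift_eq_sum_fwdDiff_iter 1 f n N
    rw [smul_eq_mul, mul_one, add_comm N] at this
    rw [this]
    symm
    simp_rw [nsmul_eq_mul]
    refine Finset.sum_subset (Finset.range_mono (by lia)) fun k _ hk => ?_
    rw [hz' k (by simpa using hk), mul_zero]
  rw [← tendsto_add_atTop_iff_nat N]
  have h1 : Tendsto (fun n : ℕ => ∑ k ∈ Finset.range (d + 1),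
      (n.choose k : ℝ) / (n : ℝ) ^ d * ((fwdDiff 1)^[k] f N : ℤ)) atTop
      (𝓝 (∑ k ∈ Finset.range (d + 1), if k = d then (c : ℝ) / d.factorial else 0)) := by
    refine tendsto_finsetSum _ fun k hk => ?_
    rcases (Nat.lt_succ_iff.mp (Finset.mem_range.mp hk)).eq_or_lt with rfl | hkd
    · rw [if_pos rfl, hN N le_rfl, div_eq_mul_one_div, mul_comm (c : ℝ)]
      exact (tendsto_choose_div_pow k).mul_const _
    · rw [if_neg hkd.ne]
      simpa using (tendsto_choose_div_pow_of_lt hkd).mul_const (((fwdDiff 1)^[k] f N : ℤ) : ℝ)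
  have h2 := ((h1.const_mul (d.factorial : ℝ)).mul (tendsto_pow_div_add_pow d N))
  have hd : (d.factorial : ℝ) ≠ 0 := by positivity
  simp only [Finset.sum_ite_eq', Finset.mem_range, Nat.lt_succ_self, if_true, mul_one,
    mul_div_cancel₀ _ hd] at h2
  refine h2.congr' ?_
  filter_upwards [eventually_ge_atTop d, eventually_gt_atTop 0] with n hn hn0
  have : (n : ℝ) ≠ 0 := by positivity
  rw [key n hn]
  push_cast
  rw [mul_assoc, Finset.sum_mul, mul_div_assoc, Finset.sum_div]
  congr 1
  refine Finset.sum_congr rfl fun k _ => ?_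
  field_simp

/-- Descent on `r`: the last nonvanishing difference gives the leading growth of `f`. In degree
above `d` the bound forces it to be zero; in degree `d` nonnegativity of `f` makes it a natural
number. -/
theorem exists_eventually_fwdDiff_eq {f : ℕ → ℤ} {d : ℕ} {C : ℝ} (h0 : ∀ n, 0 ≤ f n)
    (hC : ∀ᶠ n in atTop, (f n : ℝ) ≤ C * (n : ℝ) ^ d) {r : ℕ} (hr : FwdDiffEventuallyZero r f) :
    ∃ e : ℕ, ∀ᶠ n in atTop, (fwdDiff 1)^[d] f n = e := by
  induction r with
  | zero =>
    refine ⟨0, ?_⟩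
    obtain ⟨N, hN⟩ := eventually_atTop.mp hr
    exact eventually_atTop.mpr ⟨N, fwdDiff_iter_eq_zero_of_forall_ge hN d⟩
  | succ r ih =>
    rcases lt_or_ge r d with hrd | hrd
    · refine ⟨0, ?_⟩
      obtain ⟨N, hN⟩ := eventually_atTop.mp hr
      refine eventually_atTop.mpr ⟨N, fun n hn => ?_⟩
      have := fwdDiff_iter_eq_zero_of_forall_ge hN (d - (r + 1)) n hn
      rwa [← Function.iterate_add_apply, Nat.sub_add_cancel hrd] at this
    · obtain ⟨c, hc⟩ := eventually_eq_of_eventually_fwdDiff_eq_zero (g := (fwdDiff 1)^[r] f) (by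
        filter_upwards [hr] with n hn
        rwa [Function.iterate_succ_apply'] at hn)
      have ht := tendsto_of_eventually_fwdDiff_eq hc
      rcases hrd.eq_or_lt with rfl | hlt
      · have hc0 : (0 : ℝ) ≤ c := ge_of_tendsto' ht fun n => by
          have : (0 : ℝ) ≤ f n := by exact_mod_cast h0 n
          positivity
        lift c to ℕ using by exact_mod_cast hc0
        exact ⟨c, hc⟩
      · have h1 : Tendsto (fun n : ℕ => (r.factorial : ℝ) * C * ((n : ℝ) ^ (r - d))⁻¹)
            atTop (𝓝 0) := by
          have : Tendsto (fun n : ℕ => ((n : ℝ) ^ (r - d))⁻¹) atTop (𝓝 0) :=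
            tendsto_inv_atTop_zero.comp
              ((tendsto_pow_atTop (by lia)).comp tendsto_natCast_atTop_atTop)
          simpa using this.const_mul ((r.factorial : ℝ) * C)
        have h2 : Tendsto (fun n : ℕ => ((r.factorial : ℝ) * (f n : ℝ)) / (n : ℝ) ^ r)
            atTop (𝓝 0) := by
          refine tendsto_of_tendsto_of_tendsto_of_le_of_le' tendsto_const_nhds h1
            (Eventually.of_forall fun n => ?_) ?_
          · have : (0 : ℝ) ≤ f n := by exact_mod_cast h0 n
            positivity
          · filter_upwards [hC, eventually_gt_atTop 0] with n hn hn0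
            have hn' : (0 : ℝ) < n := by exact_mod_cast hn0
            rw [div_le_iff₀ (by positivity), mul_assoc, mul_assoc]
            refine mul_le_mul_of_nonneg_left ?_ (by positivity)
            refine hn.trans_eq ?_
            rw [← Nat.sub_add_cancel hlt.le, pow_add]
            simp only [Nat.add_sub_cancel]
            field_simp
        have hc0 : c = 0 := by exact_mod_cast tendsto_nhds_unique ht h2
        subst hc0
        exact ih hc

end Asymptotics

/-! ### Peeling off generators one at a time. -/

section Colength

variable {A : Type*} [CommRing A]

@[simp]
theorem Ideal.colength_top : (⊤ : Ideal A).colength = 0 := by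
  have : Subsingleton (A ⧸ (⊤ : Ideal A)) := Ideal.Quotient.subsingleton_iff.mpr rfl
  simp [Ideal.colength, Module.length_eq_zero]

variable [IsLocalRing A] [IsNoetherianRing A]

theorem colength_lt_colength {J K : Ideal A} {n : ℕ} (h : maximalIdeal A ^ n ≤ J) (hJK : J < K) :
    K.colength < J.colength := by
  have hlen := Module.length_quotient_eq_add_of_le (R := A) hJK.le
  have hpos : Module.length A (Submodule.map (Submodule.mkQ J) K) ≠ 0 := by
    rw [Ne, Module.length_eq_zero_iff, Submodule.subsingleton_iff_eq_bot, Submodule.eq_bot_iff]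
    exact fun h0 => hJK.not_ge fun a ha => (Submodule.Quotient.mk_eq_zero J).mp (h0 _ ⟨a, ha, rfl⟩)
  rw [← coe_colength h, ← coe_colength (h.trans hJK.le)] at hlen
  refine lt_of_le_of_ne (colength_anti h hJK.le) fun he => hpos ?_
  rw [he] at hlen
  generalize Module.length A (Submodule.map (Submodule.mkQ J) K) = t at hlen
  induction t with
  | top => simp at hlen
  | coe t =>
    norm_cast at hlen ⊢
    lia

/-- Adjoining the `u i` from the largest index downwards gives a filtration whose step at `i` is
cyclic, with annihilator the colon ideal of `u i`. -/
theorem colength_eq_add_sum_comap {ι : Type*} [LinearOrder ι] (u : ι → A) (S : Finset ι)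
    {J : Ideal A} {n : ℕ} (hJ : maximalIdeal A ^ n ≤ J) :
    J.colength = (J ⊔ Ideal.span (u '' S)).colength + ∑ i ∈ S, Ideal.colength
      (Submodule.comap (LinearMap.mulLeft A (u i)) (J ⊔ Ideal.span (u '' {j ∈ S | i < j}))) := by
  classical
  induction S using Finset.induction_on_min with
  | empty => simp
  | insert a S ha ih =>
    have haS : a ∉ S := fun h => lt_irrefl a (ha a h)
    have h1 : {j | j ∈ insert a S ∧ a < j} = (S : Set ι) := by
      ext j
      simp only [Finset.mem_insert, Set.mem_ofPred_eq, Finset.mem_coe]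
      exact ⟨fun ⟨h, h'⟩ => h.resolve_left h'.ne', fun h => ⟨Or.inr h, ha j h⟩⟩
    have h2 : ∀ i ∈ S, {j | j ∈ insert a S ∧ i < j} = {j | j ∈ S ∧ i < j} := by
      intro i hi
      ext j
      simp only [Finset.mem_insert, Set.mem_ofPred_eq]
      exact ⟨fun ⟨h, h'⟩ => ⟨h.resolve_left fun e => lt_asymm (ha i hi) (e ▸ h'), h'⟩,
        fun ⟨h, h'⟩ => ⟨Or.inr h, h'⟩⟩
    have h3 := Finset.sum_congr rfl fun i hi => congrArg (fun T => Ideal.colength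
      (Submodule.comap (LinearMap.mulLeft A (u i)) (J ⊔ Ideal.span (u '' T)))) (h2 i hi)
    rw [Finset.sum_insert haS, h1, h3, ih, colength_eq_add_colength_comap (u a)
      (hJ.trans le_sup_left : maximalIdeal A ^ n ≤ J ⊔ Ideal.span (u '' S)),
      Finset.coe_insert, Set.image_insert_eq,
      Ideal.span_insert, sup_assoc, sup_comm (Ideal.span {u a}), add_assoc]

end Colength

/-! ### Lexicographic monomials and lengths modulo powers of a parameter ideal. -/

section LexMonomials

/-- The exponents of the monomials in `d` variables, ordered lexicographically. -/
abbrev LexExponent (d : ℕ) : Type := Lex (Fin d → ℕ)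

/-- The total degree of an exponent. -/
def LexExponent.degree {d : ℕ} (α : LexExponent d) : ℕ := ∑ i, ofLex α i

/-- The exponents of degree less than `n`. -/
noncomputable def exponentsDegreeLT (d n : ℕ) : Finset (LexExponent d) :=
  (Finset.range n).biUnion fun k =>
    (Finset.finsuppAntidiag Finset.univ k).image fun f : Fin d →₀ ℕ => toLex ⇑f

theorem mem_exponentsDegreeLT {d n : ℕ} {α : LexExponent d} :
    α ∈ exponentsDegreeLT d n ↔ α.degree < n := by
  simp only [exponentsDegreeLT, Finset.mem_biUnion, Finset.mem_range, Finset.mem_image,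
    Finset.mem_finsuppAntidiag, Finset.subset_univ, and_true]
  constructor
  · rintro ⟨k, hk, f, hf, rfl⟩
    exact hf.trans_lt hk
  · intro h
    exact ⟨α.degree, h, Finsupp.equivFunOnFinite.symm (ofLex α), rfl, rfl⟩

theorem card_exponentsDegreeLT_succ (d n : ℕ) :
    (exponentsDegreeLT d (n + 1)).card = (n + d).choose d := by
  rw [exponentsDegreeLT, Finset.card_biUnion]
  · have : ∀ k ∈ Finset.range (n + 1), ((Finset.finsuppAntidiag Finset.univ k).image
        fun f : Fin d →₀ ℕ => toLex ⇑f).card = d.multichoose k := fun k _ => by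
      rw [Finset.card_image_of_injective _ fun f g h => DFunLike.coe_injective (toLex.injective h),
        Finset.card_finsuppAntidiag_nat_eq_multichoose, Finset.card_univ, Fintype.card_fin]
    rw [Finset.sum_congr rfl this, Nat.sum_range_multichoose]
  · intro k _ l _ hkl
    refine Finset.disjoint_left.mpr ?_
    intro α hα hα'
    simp only [Finset.mem_image, Finset.mem_finsuppAntidiag] at hα hα'
    obtain ⟨f, ⟨hf, -⟩, rfl⟩ := hα
    obtain ⟨g, ⟨hg, -⟩, hgf⟩ := hα'
    have : g = f := DFunLike.coe_injective (toLex.injective hgf)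
    exact hkl (by rw [← hf, ← hg, this])

theorem tendsto_card_exponentsDegreeLT (d : ℕ) :
    Tendsto (fun n : ℕ => ((d.factorial : ℝ) * ((exponentsDegreeLT d n).card : ℝ)) / (n : ℝ) ^ d)
      atTop (𝓝 1) := by
  have h := tendsto_of_eventually_fwdDiff_eq (f := fun n => ((exponentsDegreeLT d n).card : ℤ))
    (d := d) (c := 1) (by
      filter_upwards [eventually_gt_atTop 0] with n hn
      obtain ⟨n, rfl⟩ : ∃ k, n = k + 1 := ⟨n - 1, by lia⟩
      rw [← fwdDiff_iter_comp_add]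
      have hc : (fun k => ((exponentsDegreeLT d (k + 1)).card : ℤ)) =
          fun k => ((k + d).choose d : ℤ) := by
        funext k
        rw [card_exponentsDegreeLT_succ]
      rw [hc]
      rw [fwdDiff_iter_comp_add 1 (fun x : ℕ => (x.choose d : ℤ)) d d n]
      have := fwdDiff_iter_choose 0 d
      simp only [add_zero] at this
      rw [this]
      simp)
  simpa using h

theorem tendsto_card_exponentsDegreeLT_sub (d r : ℕ) :
    Tendsto (fun n : ℕ =>
      ((d.factorial : ℝ) * ((exponentsDegreeLT d (n - r)).card : ℝ)) / (n : ℝ) ^ d)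
      atTop (𝓝 1) := by
  rw [← tendsto_add_atTop_iff_nat r]
  have h := (tendsto_card_exponentsDegreeLT d).mul (tendsto_pow_div_add_pow d r)
  rw [mul_one] at h
  refine h.congr' ?_
  filter_upwards [eventually_gt_atTop 0] with n hn
  have : (n : ℝ) ≠ 0 := by positivity
  rw [Nat.add_sub_cancel]
  field_simp

variable {A : Type*} [CommRing A] {d : ℕ} (x : Fin d → A)

/-- The monomial in the elements `x i` with exponent `α`. -/
def lexMonomial (α : LexExponent d) : A := ∏ i, x i ^ ofLex α i

theorem lexMonomial_add (α β : LexExponent d) :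
    lexMonomial x (α + β) = lexMonomial x α * lexMonomial x β := by
  simp only [lexMonomial, ← Finset.prod_mul_distrib, ← pow_add]
  rfl

@[simp]
theorem lexMonomial_zero : lexMonomial x 0 = 1 := by
  refine Finset.prod_eq_one fun i _ => ?_
  exact pow_zero _

/-- The exponent of the monomial `x i ^ k`. -/
def LexExponent.single (i : Fin d) (k : ℕ) : LexExponent d := toLex (Pi.single i k)

theorem lexMonomial_single (i : Fin d) (k : ℕ) :
    lexMonomial x (LexExponent.single i k) = x i ^ k := by
  rw [lexMonomial, Finset.prod_eq_single i]
  · simp [LexExponent.single]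
  · intro j _ hj
    simp [LexExponent.single, hj]
  · simp

theorem lexMonomial_mem_pow (α : LexExponent d) :
    lexMonomial x α ∈ Ideal.span (Set.range x) ^ α.degree := by
  rw [LexExponent.degree, ← Finset.prod_pow_eq_pow_sum]
  exact Ideal.prod_mem_prod fun i _ =>
    Ideal.pow_mem_pow (Ideal.subset_span (Set.mem_range_self i)) _

theorem LexExponent.degree_add (α β : LexExponent d) :
    (α + β).degree = α.degree + β.degree :=
  Finset.sum_add_distrib

theorem LexExponent.lt_add_single (α : LexExponent d) (i : Fin d) : α < α + single i 1 := by
  refine lt_add_of_pos_right α ?_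
  refine Pi.toLex_strictMono (a := 0) (b := Pi.single i 1) ?_
  exact Pi.lt_def.mpr ⟨fun j => Nat.zero_le _, i, by simp⟩

/-- The ideal generated by the monomials that are lexicographically larger than `α`. -/
def lexIdealGT (α : LexExponent d) : Ideal A := Ideal.span (lexMonomial x '' Set.Ioi α)

theorem mul_mem_lexIdealGT_of_mem_span {α : LexExponent d} {c : A}
    (hc : c ∈ Ideal.span (Set.range x)) : c * lexMonomial x α ∈ lexIdealGT x α := by
  induction hc using Submodule.span_induction with
  | mem y hy =>
    obtain ⟨i, rfl⟩ := hy
    refine Ideal.subset_span ⟨α + LexExponent.single i 1, α.lt_add_single i, ?_⟩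
    rw [lexMonomial_add, lexMonomial_single, pow_one, mul_comm]
  | zero => simp
  | add a b _ _ ha hb => rw [add_mul]; exact add_mem ha hb
  | smul r a _ ha => rw [smul_mul_assoc]; exact Submodule.smul_mem _ r ha

theorem mul_lexMonomial_mem_lexIdealGT {α : LexExponent d} (γ : LexExponent d) {c : A}
    (hc : c ∈ lexIdealGT x α) : c * lexMonomial x γ ∈ lexIdealGT x (α + γ) := by
  rw [lexIdealGT] at hc
  induction hc using Submodule.span_induction with
  | mem y hy =>
    obtain ⟨β, hβ, rfl⟩ := hy
    exact Ideal.subset_span ⟨β + γ, add_lt_add_left (Set.mem_Ioi.mp hβ) γ, lexMonomial_add x β γ⟩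
  | zero => simp
  | add a b _ _ ha hb => rw [add_mul]; exact add_mem ha hb
  | smul r a _ ha => rw [smul_mul_assoc]; exact Submodule.smul_mem _ r ha

variable [IsLocalRing A] [IsNoetherianRing A]

/-- Each colon ideal in the monomial filtration of `A / I ^ n` contains `I`, so each factor
contributes at most `ℓ(A / I)`. At an exponent in `D` the containment is strict and at least one
unit of length is lost. -/
theorem colength_pow_add_card_filter_le {k : ℕ} (hk : maximalIdeal A ^ k ≤ Ideal.span (Set.range x))
    (D : LexExponent d → Prop) [DecidablePred D]
    (hD : ∀ α, D α → ∃ c ∉ Ideal.span (Set.range x), c * lexMonomial x α ∈ lexIdealGT x α)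
    (n : ℕ) :
    (Ideal.span (Set.range x) ^ n).colength + ((exponentsDegreeLT d n).filter D).card ≤
      (Ideal.span (Set.range x)).colength * (exponentsDegreeLT d n).card := by
  set I := Ideal.span (Set.range x) with hI
  set S := exponentsDegreeLT d n with hS
  have hkn : maximalIdeal A ^ (k * n) ≤ I ^ n := by
    rw [pow_mul]
    exact Ideal.pow_right_mono hk n
  -- The exponent `0` contributes the monomial `1` as soon as `n > 0`; for `n = 0` the power is
  -- already the unit ideal.
  have htop : I ^ n ⊔ Ideal.span (lexMonomial x '' S) = ⊤ := by
    rcases n with _ | n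
    · simp
    · refine (Ideal.eq_top_iff_one _).mpr (Ideal.mem_sup_right (Ideal.subset_span ?_))
      refine ⟨0, ?_, lexMonomial_zero x⟩
      rw [Finset.mem_coe, hS, mem_exponentsDegreeLT]
      have : LexExponent.degree (0 : LexExponent d) = 0 := Finset.sum_const_zero
      lia
  rw [colength_eq_add_sum_comap (lexMonomial x) S hkn, htop, Ideal.colength_top, zero_add,
    Finset.card_filter, ← Finset.sum_add_distrib, mul_comm, ← smul_eq_mul, ← Finset.sum_const]
  refine Finset.sum_le_sum fun α _ => ?_
  set J := I ^ n ⊔ Ideal.span (lexMonomial x '' {β | β ∈ S ∧ α < β}) with hJ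
  have hle : lexIdealGT x α ≤ J := by
    refine Ideal.span_le.mpr ?_
    rintro _ ⟨β, hβ, rfl⟩
    by_cases hβS : β ∈ S
    · exact Ideal.mem_sup_right (Ideal.subset_span ⟨β, ⟨hβS, hβ⟩, rfl⟩)
    · rw [hS, mem_exponentsDegreeLT, not_lt] at hβS
      exact Ideal.mem_sup_left (Ideal.pow_le_pow_right hβS (lexMonomial_mem_pow x β))
  have hIle : I ≤ Submodule.comap (LinearMap.mulLeft A (lexMonomial x α)) J := fun c hc => by
    rw [Submodule.mem_comap, LinearMap.mulLeft_apply, mul_comm]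
    exact hle (mul_mem_lexIdealGT_of_mem_span x hc)
  split_ifs with h
  · obtain ⟨c, hcI, hc⟩ := hD α h
    refine Nat.succ_le_of_lt (colength_lt_colength hk (lt_of_le_not_ge hIle fun h' => hcI (h' ?_)))
    rw [Submodule.mem_comap, LinearMap.mulLeft_apply, mul_comm]
    exact hle hc
  · exact colength_anti hk hIle

theorem colength_pow_le {k : ℕ} (hk : maximalIdeal A ^ k ≤ Ideal.span (Set.range x)) (n : ℕ) :
    (Ideal.span (Set.range x) ^ n).colength ≤
      (Ideal.span (Set.range x)).colength * (exponentsDegreeLT d n).card := by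
  classical
  exact (Nat.le_add_right _ _).trans
    (colength_pow_add_card_filter_le x hk (fun _ => False) (fun _ h => h.elim) n)

/-- A defect at `α` persists at every `α + γ` with the same witness `c`. Those of degree below `n`
are counted by `γ` of degree below `n - α.degree`, an empty range when the subtraction truncates. -/
theorem colength_pow_add_card_le {k : ℕ} (hk : maximalIdeal A ^ k ≤ Ideal.span (Set.range x))
    {α : LexExponent d} {c : A} (hcI : c ∉ Ideal.span (Set.range x))
    (hc : c * lexMonomial x α ∈ lexIdealGT x α) (n : ℕ) :
    (Ideal.span (Set.range x) ^ n).colength + (exponentsDegreeLT d (n - α.degree)).card ≤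
      (Ideal.span (Set.range x)).colength * (exponentsDegreeLT d n).card := by
  classical
  refine le_trans (Nat.add_le_add_left ?_ _)
    (colength_pow_add_card_filter_le x hk (fun β => ∃ γ, β = α + γ) ?_ n)
  · refine Finset.card_le_card_of_injOn (fun γ => α + γ) (fun γ hγ => ?_)
      (add_right_injective α).injOn
    rw [Finset.mem_coe, mem_exponentsDegreeLT] at hγ
    simp only [Finset.coe_filter, Set.mem_ofPred_eq, mem_exponentsDegreeLT]
    exact ⟨by rw [LexExponent.degree_add]; lia, γ, rfl⟩
  · rintro _ ⟨γ, rfl⟩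
    refine ⟨c, hcI, ?_⟩
    rw [lexMonomial_add, ← mul_assoc]
    exact mul_lexMonomial_mem_lexIdealGT x γ hc

end LexMonomials

/-! ### Absence of defects implies regularity. -/

section RegularOfNoDefect

theorem isRegular_ofFn {A : Type*} [CommRing A] [IsLocalRing A] {d : ℕ} (x : Fin d → A)
    (hm : ∀ i, x i ∈ maximalIdeal A)
    (hx : ∀ i c, x i * c ∈ Ideal.span (x '' Set.Iio i) → c ∈ Ideal.span (x '' Set.Iio i)) :
    RingTheory.Sequence.IsRegular A (List.ofFn x) := by
  refine RingTheory.Sequence.IsRegular.of_isWeaklyRegular_of_mem_maximalIdeal A (fun r hr => ?_)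
    ⟨fun i hi => ?_⟩
  · obtain ⟨i, rfl⟩ := List.mem_ofFn.mp hr
    exact hm i
  · have hid : i < d := by simpa using hi
    have he : Ideal.ofList (List.take i (List.ofFn x)) • (⊤ : Submodule A A) =
        Ideal.span (x '' Set.Iio ⟨i, hid⟩) := by
      rw [smul_eq_mul, Ideal.mul_top, Ideal.ofList]
      congr 1
      ext r
      simp only [Set.mem_ofPred_eq, List.mem_take_iff_getElem, List.getElem_ofFn,
        Set.mem_image, Set.mem_Iio]
      constructor
      · rintro ⟨j, hj, rfl⟩
        exact ⟨⟨j, by simp at hj; lia⟩, Fin.lt_def.mpr (by simp at hj ⊢; lia), rfl⟩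
      · rintro ⟨j, hj, rfl⟩
        exact ⟨j, by have := Fin.lt_def.mp hj; simp at this ⊢; lia, rfl⟩
    rw [isSMulRegular_quotient_iff_mem_of_smul_mem, he, List.getElem_ofFn]
    exact hx ⟨i, hid⟩

theorem mem_of_forall_mem_sup_maximalIdeal_pow {A : Type*} [CommRing A] [IsLocalRing A]
    [IsNoetherianRing A] {J : Ideal A} {c : A} (h : ∀ n, c ∈ J ⊔ maximalIdeal A ^ n) : c ∈ J := by
  have hk := Ideal.iInf_pow_smul_eq_bot_of_isLocalRing (M := A ⧸ J) (maximalIdeal A)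
    (Ideal.IsPrime.ne_top inferInstance)
  have hc : Ideal.Quotient.mk J c ∈
      (⨅ n, maximalIdeal A ^ n • (⊤ : Submodule A (A ⧸ J))) := by
    refine (Submodule.mem_iInf _).mpr fun n => ?_
    obtain ⟨a, ha, b, hb, hab⟩ := Submodule.mem_sup.mp (h n)
    have : Ideal.Quotient.mk J c = b • (1 : A ⧸ J) := by
      rw [← hab, map_add, Ideal.Quotient.eq_zero_iff_mem.mpr ha, zero_add, Algebra.smul_def,
        mul_one]
      rfl
    rw [this]
    exact Submodule.smul_mem_smul hb Submodule.mem_top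
  rw [hk] at hc
  exact Ideal.Quotient.eq_zero_iff_mem.mp hc

theorem mem_of_forall_mem_sup_span_pow {A : Type*} [CommRing A] [IsLocalRing A]
    [IsNoetherianRing A] {J : Ideal A} {c y : A} (hy : y ∈ maximalIdeal A)
    (h : ∀ n, c ∈ J ⊔ Ideal.span {y ^ n}) : c ∈ J :=
  mem_of_forall_mem_sup_maximalIdeal_pow fun n =>
    sup_le_sup_left ((Ideal.span_singleton_le_iff_mem _).mpr (Ideal.pow_mem_pow hy n)) J (h n)

variable {A : Type*} [CommRing A] {d : ℕ} (x : Fin d → A)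

theorem LexExponent.lt_of_forall_lt {α β : LexExponent d} (t : Fin d)
    (h : ∀ j < t, ofLex α j = ofLex β j) (ht : ofLex α t < ofLex β t) : α < β := ⟨t, h, ht⟩

theorem LexExponent.exists_of_lt {α β : LexExponent d} (h : α < β) :
    ∃ t, (∀ j < t, ofLex α j = ofLex β j) ∧ ofLex α t < ofLex β t := h

/-- The ideal generated by the monomials that are lexicographically at least `α`. -/
def lexIdealGE (α : LexExponent d) : Ideal A := Ideal.span (lexMonomial x '' Set.Ici α)

theorem lexIdealGE_eq (α : LexExponent d) :
    lexIdealGE x α = lexIdealGT x α ⊔ Ideal.span {lexMonomial x α} := by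
  rw [lexIdealGE, lexIdealGT, ← Ideal.span_union, ← Set.image_singleton, ← Set.image_union,
    Set.union_comm, Set.singleton_union, Set.Ioi_insert]

theorem pow_dvd_lexMonomial {α : LexExponent d} {i : Fin d} {k : ℕ} (h : k ≤ ofLex α i) :
    x i ^ k ∣ lexMonomial x α :=
  (pow_dvd_pow _ h).trans (Finset.dvd_prod_of_mem _ (Finset.mem_univ i))

theorem span_Iio_le_lexIdealGT {α : LexExponent d} {i : Fin d} (hα : ∀ j < i, ofLex α j = 0) :
    Ideal.span (x '' Set.Iio i) ≤ lexIdealGT x α := by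
  refine Ideal.span_le.mpr ?_
  rintro _ ⟨j, hj, rfl⟩
  refine Ideal.subset_span ⟨LexExponent.single j 1, ?_, by rw [lexMonomial_single, pow_one]⟩
  refine LexExponent.lt_of_forall_lt j (fun k hk => ?_) ?_
  · rw [hα k (hk.trans hj)]
    simp [LexExponent.single, hk.ne]
  · rw [hα j hj]
    simp [LexExponent.single]

/-- Write `c = g + a * x^α` with `g` in the larger monomials. Multiplying by `x i` puts `a * x^(α +
e_i)` into the ideal of larger monomials, so `a ∈ I` by the no-defect hypothesis, and then `a * x^α`
also involves only larger monomials. -/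
theorem mem_lexIdealGT_of_mem_lexIdealGE
    (hx : ∀ α c, c * lexMonomial x α ∈ lexIdealGT x α → c ∈ Ideal.span (Set.range x))
    {i : Fin d} {c : A} (hc : x i * c ∈ Ideal.span (x '' Set.Iio i)) {α : LexExponent d}
    (hα : ∀ j < i, ofLex α j = 0) (h : c ∈ lexIdealGE x α) : c ∈ lexIdealGT x α := by
  rw [lexIdealGE_eq] at h
  obtain ⟨g, hg, b, hb, rfl⟩ := Submodule.mem_sup.mp h
  obtain ⟨a, rfl⟩ := Ideal.mem_span_singleton'.mp hb
  refine add_mem hg (mul_mem_lexIdealGT_of_mem_span x (hx (α + LexExponent.single i 1) a ?_))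
  have h1 := span_Iio_le_lexIdealGT x (α := α + LexExponent.single i 1) (i := i) (fun j hj => by
    rw [ofLex_add, Pi.add_apply, hα j hj]
    simp [LexExponent.single, hj.ne]) hc
  have h2 := mul_lexMonomial_mem_lexIdealGT x (LexExponent.single i 1) hg
  rw [lexMonomial_add]
  rw [lexMonomial_single, pow_one] at h2 ⊢
  have := sub_mem h1 h2
  convert this using 1
  ring

variable [IsLocalRing A] [IsNoetherianRing A]

/-- Transfinite induction over exponents supported on indices `≥ i`. Successor exponents use the
preceding lemma; at limit exponents Krull's intersection theorem is needed. -/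
theorem mem_lexIdealGE (hm : ∀ i, x i ∈ maximalIdeal A)
    (hx : ∀ α c, c * lexMonomial x α ∈ lexIdealGT x α → c ∈ Ideal.span (Set.range x))
    {i : Fin d} {c : A} (hc : x i * c ∈ Ideal.span (x '' Set.Iio i)) (α : LexExponent d)
    (hα : ∀ j < i, ofLex α j = 0) : c ∈ lexIdealGE x α := by
  induction α using WellFoundedLT.induction with
  | ind α ih =>
  by_cases h0 : α = 0
  · subst h0
    have : (1 : A) ∈ lexIdealGE x 0 := Ideal.subset_span ⟨0, Set.mem_Ici.mpr le_rfl, lexMonomial_zero x⟩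
    exact (Ideal.eq_top_iff_one _).mpr this ▸ Submodule.mem_top
  obtain ⟨j, hj, hjmax⟩ : ∃ j, ofLex α j ≠ 0 ∧ ∀ k, j < k → ofLex α k = 0 := by
    have hne : (Finset.univ.filter fun j => ofLex α j ≠ 0).Nonempty := by
      by_contra hemp
      rw [Finset.not_nonempty_iff_eq_empty, Finset.filter_eq_empty_iff] at hemp
      exact h0 (ofLex.injective (funext fun j => not_not.mp (hemp (Finset.mem_univ j))))
    refine ⟨_, (Finset.mem_filter.mp (Finset.max'_mem _ hne)).2, fun k hk => ?_⟩
    by_contra hk0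
    exact hk.not_ge (Finset.le_max' _ k (Finset.mem_filter.mpr ⟨Finset.mem_univ k, hk0⟩))
  have hij : i ≤ j := le_of_not_gt fun h => hj (hα j h)
  let β : LexExponent d := toLex (Function.update (ofLex α) j (ofLex α j - 1))
  have hβ : ∀ k, k ≠ j → ofLex β k = ofLex α k := fun k hk => by simp [β, hk]
  have hβj : ofLex β j + 1 = ofLex α j := by
    rw [ofLex_toLex, Function.update_self]
    lia
  -- If `j` is not the last index, `α` is a limit: lowering its entry at `j` by one and putting `n`
  -- at the next index `l` gives exponents `γ < α` for all `n`.
  by_cases hlast : ∃ l, j < l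
  · obtain ⟨l, hl, hlmin⟩ : ∃ l : Fin d, j < l ∧ ∀ k, j < k → l ≤ k := by
      obtain ⟨l, hl⟩ := hlast
      have hjd : (j : ℕ) + 1 < d := lt_of_le_of_lt (Nat.succ_le_of_lt (Fin.lt_def.mp hl)) l.2
      exact ⟨⟨j + 1, hjd⟩, Fin.lt_def.mpr (Nat.lt_succ_self _),
        fun k hk => Fin.le_def.mpr (Nat.succ_le_of_lt (Fin.lt_def.mp hk))⟩
    refine mem_of_forall_mem_sup_span_pow (hm l) fun n => ?_
    let γ : LexExponent d := toLex (Function.update (ofLex β) l n)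
    have hγ : ∀ k, k ≠ l → ofLex γ k = ofLex β k := fun k hk => by simp [γ, hk]
    have hγl : ofLex γ l = n := by simp [γ]
    have hγα : γ < α := by
      refine LexExponent.lt_of_forall_lt j (fun k hk => ?_) ?_
      · rw [hγ k (hk.trans hl).ne, hβ k hk.ne]
      · rw [hγ j hl.ne]
        lia
    have hcγ : c ∈ lexIdealGE x γ := ih γ hγα fun k hk => by
      rw [hγ k (hk.trans_le (hij.trans hl.le)).ne, hβ k (hk.trans_le hij).ne, hα k hk]
    refine (Ideal.span_le.mpr ?_ : lexIdealGE x γ ≤ _) hcγ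
    rintro _ ⟨δ, hδ, rfl⟩
    by_cases hδl : n ≤ ofLex δ l
    · exact Ideal.mem_sup_right (Ideal.mem_span_singleton.mpr (pow_dvd_lexMonomial x hδl))
    -- When `δ ≥ γ` and `δ l < n`, the first difference occurs at an index at most `j`. There `δ`
    -- exceeds `γ`, and since `α` vanishes beyond `j` this already forces `δ ≥ α`.
    refine Ideal.mem_sup_left (Ideal.subset_span ⟨δ, ?_, rfl⟩)
    rcases (Set.mem_Ici.mp hδ).eq_or_lt with rfl | hlt
    · exact absurd hγl.ge hδl
    obtain ⟨t, ht, htlt⟩ := LexExponent.exists_of_lt hlt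
    have htl : t < l := by
      by_contra htl
      rcases (not_lt.mp htl).eq_or_lt with rfl | hlt'
      · lia
      · exact hδl (by rw [← ht l hlt', hγl])
    have htj : t ≤ j := le_of_not_gt fun h => (hlmin t h).not_gt htl
    rcases htj.eq_or_lt with rfl | htj
    · rw [hγ t htl.ne] at htlt
      rcases (show ofLex α t ≤ ofLex δ t by lia).eq_or_lt with he | he
      · by_cases hδα : ∀ k, t < k → ofLex δ k = 0
        · refine (ofLex.injective (funext fun k => ?_) : α = δ).le
          rcases lt_trichotomy k t with hk | rfl | hk
          · rw [← ht k hk, hγ k (hk.trans htl).ne, hβ k hk.ne]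
          · exact he
          · rw [hδα k hk, hjmax k hk]
        · refine Set.mem_Ici.mpr (le_of_lt ?_)
          by_contra hnlt
          rcases (not_lt.mp hnlt).eq_or_lt with rfl | hlt2
          · exact hδα hjmax
          obtain ⟨s, hs, hslt⟩ := LexExponent.exists_of_lt hlt2
          rcases lt_trichotomy s t with hst | rfl | hst
          · rw [← ht s hst, hγ s (hst.trans htl).ne, hβ s hst.ne] at hslt
            exact lt_irrefl _ hslt
          · exact hslt.ne' he
          · rw [hjmax s hst] at hslt
            exact Nat.not_lt_zero _ hslt
      · refine (LexExponent.lt_of_forall_lt t (fun k hk => ?_) he).le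
        rw [← ht k hk, hγ k (hk.trans htl).ne, hβ k hk.ne]
    · refine (LexExponent.lt_of_forall_lt t (fun k hk => ?_) ?_).le
      · rw [← ht k hk, hγ k (hk.trans htl).ne, hβ k (hk.trans htj).ne]
      · rwa [hγ t htl.ne, hβ t htj.ne] at htlt
  · push Not at hlast
    -- With `j` the last index, `α` is the immediate successor of `β`, so strictly above `β` means
    -- at least `α`.
    have hβα : β < α := LexExponent.lt_of_forall_lt j (fun k hk => hβ k hk.ne) (by lia)
    have hβi : ∀ k < i, ofLex β k = 0 := fun k hk => by
      rw [hβ k (hk.trans_le hij).ne, hα k hk]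
    have hcβ := mem_lexIdealGT_of_mem_lexIdealGE x hx hc hβi (ih β hβα hβi)
    refine (Ideal.span_mono (Set.image_mono fun δ hδ => ?_) :
      lexIdealGT x β ≤ lexIdealGE x α) hcβ
    obtain ⟨t, ht, htlt⟩ := LexExponent.exists_of_lt (Set.mem_Ioi.mp hδ)
    rcases (hlast t).eq_or_lt with rfl | htj
    · rcases (show ofLex α t ≤ ofLex δ t by lia).eq_or_lt with he | he
      · refine (ofLex.injective (funext fun k => ?_) : α = δ).le
        rcases (hlast k).eq_or_lt with rfl | hk
        · exact he
        · rw [← ht k hk, hβ k hk.ne]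
      · exact (LexExponent.lt_of_forall_lt t (fun k hk => by rw [← ht k hk, hβ k hk.ne]) he).le
    · refine (LexExponent.lt_of_forall_lt t (fun k hk => ?_) ?_).le
      · rw [← ht k hk, hβ k (hk.trans htj).ne]
      · rwa [hβ t htj.ne] at htlt

/-- A monomial lexicographically at least `x i ^ n` is divisible by `x i ^ n` or by some `x j` with
`j < i`. Letting `n` grow, Krull's theorem removes the power of `x i`. -/
theorem mem_span_Iio_of_mul_mem (hm : ∀ i, x i ∈ maximalIdeal A)
    (hx : ∀ α c, c * lexMonomial x α ∈ lexIdealGT x α → c ∈ Ideal.span (Set.range x))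
    (i : Fin d) (c : A) (hc : x i * c ∈ Ideal.span (x '' Set.Iio i)) :
    c ∈ Ideal.span (x '' Set.Iio i) := by
  refine mem_of_forall_mem_sup_span_pow (hm i) fun n => ?_
  have h := mem_lexIdealGE x hm hx hc (LexExponent.single i n) fun j hj => by
    simp [LexExponent.single, hj.ne]
  refine (Ideal.span_le.mpr ?_ : lexIdealGE x (LexExponent.single i n) ≤ _) h
  rintro _ ⟨δ, hδ, rfl⟩
  by_cases hδi : n ≤ ofLex δ i
  · exact Ideal.mem_sup_right (Ideal.mem_span_singleton.mpr (pow_dvd_lexMonomial x hδi))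
  have hsi : ofLex (LexExponent.single i n) i = n := by simp [LexExponent.single]
  rcases (Set.mem_Ici.mp hδ).eq_or_lt with rfl | hlt
  · exact absurd hsi.ge hδi
  obtain ⟨t, ht, htlt⟩ := LexExponent.exists_of_lt hlt
  have hti : t < i := by
    by_contra hti
    rcases (not_lt.mp hti).eq_or_lt with rfl | hlt'
    · lia
    · exact hδi (by rw [← ht i hlt', hsi])
  refine Ideal.mem_sup_left (Ideal.mem_of_dvd _ (pow_dvd_lexMonomial x (i := t) (k := 1) ?_) ?_)
  · lia
  · rw [pow_one]
    exact Ideal.subset_span ⟨t, hti, rfl⟩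

end RegularOfNoDefect

/-! ### Depth does not depend on the regular element chosen. -/

section DepthOfIdeals

variable {A : Type*} [CommRing A]

/-- Multiplication by `x` is injective modulo `J`. -/
def IsRegularMod (J : Ideal A) (x : A) : Prop := ∀ a, x * a ∈ J → a ∈ J

theorem IsRegularMod.swap {J : Ideal A} {y z : A} (hy : IsRegularMod J y)
    (hz : IsRegularMod (J ⊔ Ideal.span {y}) z) : IsRegularMod (J ⊔ Ideal.span {z}) y := by
  intro a ha
  obtain ⟨j, hj, b, hb, hjb⟩ := Submodule.mem_sup.mp ha
  obtain ⟨b, rfl⟩ := Ideal.mem_span_singleton'.mp hb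
  have h1 : z * b ∈ J ⊔ Ideal.span {y} := by
    have : z * b = -j + a * y := by linear_combination hjb
    rw [this]
    exact Submodule.add_mem_sup (J.neg_mem hj) (Ideal.mem_span_singleton'.mpr ⟨a, rfl⟩)
  obtain ⟨j', hj', b', hb', hjb'⟩ := Submodule.mem_sup.mp (hz b h1)
  obtain ⟨b', rfl⟩ := Ideal.mem_span_singleton'.mp hb'
  have h2 : a - z * b' ∈ J := by
    refine hy _ ?_
    have : y * (a - z * b') = j + z * j' := by linear_combination -hjb - z * hjb'
    rw [this]
    exact J.add_mem hj (J.mul_mem_left z hj')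
  have : a = (a - z * b') + b' * z := by ring
  rw [this]
  exact Submodule.add_mem_sup h2 (Ideal.mem_span_singleton'.mpr ⟨b', rfl⟩)

theorem isRegularMod_iff_notMem_associatedPrimes [IsNoetherianRing A] {J : Ideal A} {x : A} :
    IsRegularMod J x ↔ ∀ p ∈ associatedPrimes A (A ⧸ J), x ∉ p := by
  have h := Set.ext_iff.mp (biUnion_associatedPrimes_eq_compl_regular A (A ⧸ J)) x
  rw [Set.mem_compl_iff, Set.mem_ofPred_eq, isSMulRegular_quotient_iff_mem_of_smul_mem] at h
  change (∀ a, x * a ∈ J → a ∈ J) ↔ _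
  rw [← not_iff_not, ← (show _ ↔ ¬ ∀ a, x * a ∈ J → a ∈ J from h)]
  simp

variable [IsLocalRing A]

/-- There is a sequence of length `n` of elements of the maximal ideal that is regular
modulo `J`. -/
def HasDepthGE : ℕ → Ideal A → Prop
  | 0, _ => True
  | n + 1, J => ∃ x ∈ maximalIdeal A, IsRegularMod J x ∧ HasDepthGE n (J ⊔ Ideal.span {x})

/-- No element outside of `J` is multiplied into `J` by the maximal ideal. -/
def HasTrivialSocle (J : Ideal A) : Prop := ∀ a, (∀ y ∈ maximalIdeal A, y * a ∈ J) → a ∈ J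

theorem IsRegularMod.hasTrivialSocle {J : Ideal A} {x : A} (h : IsRegularMod J x)
    (hx : x ∈ maximalIdeal A) : HasTrivialSocle J := fun a ha => h a (ha x hx)

/-- The relation `x * a = y * b` modulo `J` transports a socle element `a` modulo `J + (y)` to a
socle element `b` modulo `J + (x)`; regularity of `x` carries triviality back. -/
theorem HasTrivialSocle.of_sup_span {J : Ideal A} {x y : A} (hx : IsRegularMod J x)
    (hy : IsRegularMod J y) (hxm : x ∈ maximalIdeal A)
    (h : HasTrivialSocle (J ⊔ Ideal.span {x})) : HasTrivialSocle (J ⊔ Ideal.span {y}) := by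
  intro a ha
  obtain ⟨j, hj, b, hb, hjb⟩ := Submodule.mem_sup.mp (ha x hxm)
  obtain ⟨b, rfl⟩ := Ideal.mem_span_singleton'.mp hb
  have h1 : b ∈ J ⊔ Ideal.span {x} := by
    refine h b fun w hw => ?_
    obtain ⟨j', hj', b', hb', hjb'⟩ := Submodule.mem_sup.mp (ha w hw)
    obtain ⟨b', rfl⟩ := Ideal.mem_span_singleton'.mp hb'
    have h2 : w * b - x * b' ∈ J := by
      refine hy _ ?_
      have : y * (w * b - x * b') = x * j' - w * j := by
        linear_combination w * hjb - x * hjb'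
      rw [this]
      exact J.sub_mem (J.mul_mem_left x hj') (J.mul_mem_left w hj)
    have : w * b = (w * b - x * b') + b' * x := by ring
    rw [this]
    exact Submodule.add_mem_sup h2 (Ideal.mem_span_singleton'.mpr ⟨b', rfl⟩)
  obtain ⟨j', hj', b', hb', hjb'⟩ := Submodule.mem_sup.mp h1
  obtain ⟨b', rfl⟩ := Ideal.mem_span_singleton'.mp hb'
  have h2 : a - b' * y ∈ J := by
    refine hx _ ?_
    have : x * (a - b' * y) = j + y * j' := by linear_combination -hjb - y * hjb'
    rw [this]
    exact J.add_mem hj (J.mul_mem_left y hj')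
  have : a = (a - b' * y) + b' * y := by ring
  rw [this]
  exact Submodule.add_mem_sup h2 (Ideal.mem_span_singleton'.mpr ⟨b', rfl⟩)

theorem HasDepthGE.of_comap {B : Type*} [CommRing B] [IsLocalRing B] {f : A →+* B}
    (hf : Function.Surjective f) {n : ℕ} : ∀ {J : Ideal B}, HasDepthGE n (J.comap f) →
    HasDepthGE n J := by
  induction n with
  | zero => intros; trivial
  | succ n ih =>
    rintro J ⟨x, hxm, hx, hd⟩
    have := hf.isLocalHom
    refine ⟨f x, ?_, ?_, ih ?_⟩
    · exact fun hu => hxm (isUnit_of_map_unit f x hu)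
    · intro b hb
      obtain ⟨a, rfl⟩ := hf b
      exact hx a (by rwa [Ideal.mem_comap, map_mul])
    · convert hd using 1
      ext a
      simp only [Ideal.mem_comap, Submodule.mem_sup, Ideal.mem_span_singleton']
      constructor
      · rintro ⟨j, hj, _, ⟨b, rfl⟩, hab⟩
        obtain ⟨b, rfl⟩ := hf b
        refine ⟨a - b * x, ?_, _, ⟨b, rfl⟩, by ring⟩
        rwa [map_sub, map_mul, ← hab, add_sub_cancel_right]
      · rintro ⟨j, hj, _, ⟨b, rfl⟩, rfl⟩
        exact ⟨f j, hj, _, ⟨f b, rfl⟩, by simp⟩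

theorem hasDepthGE_ofList_of_isWeaklyRegular {rs : List A}
    (hm : ∀ r ∈ rs, r ∈ maximalIdeal A) : ∀ {J : Ideal A},
    (∀ i (h : i < rs.length), IsRegularMod (J ⊔ Ideal.ofList (rs.take i)) rs[i]) →
    HasDepthGE rs.length J := by
  induction rs with
  | nil => intros; trivial
  | cons x rs ih =>
    intro J h
    refine ⟨x, hm x (by simp), ?_, ih (fun r hr => hm r (by simp [hr])) fun i hi => ?_⟩
    · have := h 0 (by simp)
      simpa only [List.take_zero, Ideal.ofList_nil, sup_bot_eq, List.getElem_cons_zero] using this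
    · have := h (i + 1) (by simpa using hi)
      rwa [List.take_succ_cons, Ideal.ofList_cons, ← sup_assoc] at this

theorem hasDepthGE_of_isRegular {rs : List A} (h : RingTheory.Sequence.IsRegular A rs) :
    HasDepthGE rs.length (⊥ : Ideal A) := by
  refine hasDepthGE_ofList_of_isWeaklyRegular (fun r hr => ?_) fun i hi a ha => ?_
  · by_contra hr'
    have hu : IsUnit r := by simpa using hr'
    refine h.top_ne_smul ?_
    have : Ideal.ofList rs = ⊤ := Ideal.eq_top_of_isUnit_mem _ (Ideal.subset_span hr) hu
    simp [this]
  · have := (isSMulRegular_quotient_iff_mem_of_smul_mem _ _).mp (h.regular_mod_prev i hi) a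
    rw [smul_eq_mul, smul_eq_mul, Ideal.mul_top] at this
    rw [bot_sup_eq] at ha ⊢
    exact this ha

variable [IsNoetherianRing A]

theorem HasTrivialSocle.not_le_of_mem_associatedPrimes {J p : Ideal A} (h : HasTrivialSocle J)
    (hp : p ∈ associatedPrimes A (A ⧸ J)) : ¬ maximalIdeal A ≤ p := by
  intro hle
  obtain ⟨hprime, a, ha⟩ := isAssociatedPrime_iff.mp hp
  obtain ⟨a, rfl⟩ := Ideal.Quotient.mk_surjective a
  have haJ : a ∈ J := h a fun y hy => by
    have := hle hy
    rw [ha, Submodule.mem_colon_singleton] at this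
    exact (Submodule.Quotient.mk_eq_zero J).mp this
  refine hprime.ne_top ((Ideal.eq_top_iff_one _).mpr ?_)
  rw [ha, Submodule.mem_colon_singleton, one_smul]
  exact (Submodule.Quotient.mk_eq_zero J).mpr haJ

/-- A trivial socle means that `𝔪` is not an associated prime. Prime avoidance then applies to all
the associated primes together. -/
theorem exists_isRegularMod_of_hasTrivialSocle {s : Set (Ideal A)} (hs : s.Finite)
    (h : ∀ J ∈ s, HasTrivialSocle J) : ∃ z ∈ maximalIdeal A, ∀ J ∈ s, IsRegularMod J z := by
  let T : Set (Ideal A) := ⋃ J ∈ s, associatedPrimes A (A ⧸ J)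
  have hT : T.Finite := hs.biUnion fun J _ => associatedPrimes.finite A (A ⧸ J)
  have hne : ¬ ((maximalIdeal A : Set A) ⊆ ⋃ p ∈ T, (p : Set A)) := by
    rw [Ideal.subset_union_prime_finite hT (f := fun p => p) ⊤ ⊤]
    · rintro ⟨p, hp, hle⟩
      obtain ⟨J, hJ, hp⟩ := Set.mem_iUnion₂.mp hp
      exact (h J hJ).not_le_of_mem_associatedPrimes hp hle
    · intro p hp _ _
      obtain ⟨J, hJ, hp⟩ := Set.mem_iUnion₂.mp hp
      exact hp.1
  obtain ⟨z, hz, hzT⟩ := Set.not_subset.mp hne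
  refine ⟨z, hz, fun J hJ => isRegularMod_iff_notMem_associatedPrimes.mpr fun p hp hzp => hzT ?_⟩
  exact Set.mem_iUnion₂.mpr ⟨p, Set.mem_iUnion₂.mpr ⟨J, hJ, hp⟩, hzp⟩

/-- Choose `z` regular modulo `J`, `J + (x)` and `J + (y)` at once. By induction `z` replaces the
next element modulo `J + (x)`, and then `y` replaces `x` modulo `J + (z)`. -/
theorem HasDepthGE.exchange {n : ℕ} : ∀ {J : Ideal A} {x y : A}, x ∈ maximalIdeal A →
    y ∈ maximalIdeal A → IsRegularMod J x → IsRegularMod J y →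
    HasDepthGE n (J ⊔ Ideal.span {x}) → HasDepthGE n (J ⊔ Ideal.span {y}) := by
  induction n with
  | zero => intros; trivial
  | succ n ih =>
    rintro J x y hxm hym hx hy ⟨z', hz'm, hz', hd⟩
    have hsx := hz'.hasTrivialSocle hz'm
    obtain ⟨z, hzm, hz⟩ := exists_isRegularMod_of_hasTrivialSocle
      (s := {J, J ⊔ Ideal.span {x}, J ⊔ Ideal.span {y}}) (by simp) (by
        rintro K (rfl | rfl | rfl)
        · exact hx.hasTrivialSocle hxm
        · exact hsx
        · exact HasTrivialSocle.of_sup_span hx hy hxm hsx)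
    have hzJ := hz J (by simp)
    have hzx := hz (J ⊔ Ideal.span {x}) (by simp)
    have hzy := hz (J ⊔ Ideal.span {y}) (by simp)
    refine ⟨z, hzm, hzy, ?_⟩
    have h1 := ih hz'm hzm hz' hzx hd
    rw [sup_assoc, sup_comm (Ideal.span {x}), ← sup_assoc] at h1
    have h2 := ih hxm hym (hx.swap hzx) (hy.swap hzy) h1
    rwa [sup_assoc, sup_comm (Ideal.span {z}), ← sup_assoc] at h2

theorem HasDepthGE.sup_span {n : ℕ} {J : Ideal A} (h : HasDepthGE (n + 1) J) {y : A}
    (hym : y ∈ maximalIdeal A) (hy : IsRegularMod J y) : HasDepthGE n (J ⊔ Ideal.span {y}) := by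
  obtain ⟨x, hxm, hx, hd⟩ := h
  exact hd.exchange hxm hym hx hy

end DepthOfIdeals

/-! ### Superficial elements over an infinite residue field. -/

section SuperficialElements

variable {A : Type*} [CommRing A] [IsLocalRing A] [IsNoetherianRing A]

/-- By Nakayama proper submodules of `𝔪` stay proper in `𝔪 / 𝔪²`, and a vector space over an
infinite field is not a finite union of proper subspaces. -/
theorem exists_forall_notMem_of_infinite_residueField [Infinite (ResidueField A)]
    (s : Finset (Submodule A (maximalIdeal A))) (hs : ⊤ ∉ s) :
    ∃ x : maximalIdeal A, ∀ V ∈ s, x ∉ V := by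
  classical
  let W : Submodule A (maximalIdeal A) → Subspace (ResidueField A) (CotangentSpace A) := fun V =>
    { (V.map (maximalIdeal A).toCotangent).toAddSubmonoid with
      smul_mem' := fun r v hv => by
        obtain ⟨r, rfl⟩ := residue_surjective r
        have : residue A r • v = r • v := algebraMap_smul (ResidueField A) r v
        rw [this]
        exact (V.map (maximalIdeal A).toCotangent).smul_mem r hv }
  have hW : ⊤ ∉ s.image W := by
    intro h
    obtain ⟨V, hV, hVW⟩ := Finset.mem_image.mp h
    have : V.map (maximalIdeal A).toCotangent = ⊤ :=
      eq_top_iff.mpr fun v _ => (hVW ▸ Submodule.mem_top : v ∈ W V)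
    rw [CotangentSpace.map_eq_top_iff] at this
    exact hs (this ▸ hV)
  obtain ⟨v, hv⟩ := (Set.ne_univ_iff_exists_notMem _).mp
    (Subspace.biUnion_ne_univ_of_top_notMem hW)
  obtain ⟨x, rfl⟩ := (maximalIdeal A).toCotangent_surjective v
  refine ⟨x, fun V hV hxV => hv ?_⟩
  exact Set.mem_iUnion₂.mpr ⟨W V, Finset.mem_image_of_mem W hV, ⟨x, hxV, rfl⟩⟩

open Polynomial in
/-- The element `y * t` of the Rees algebra `A[mt]`. -/
noncomputable def reesDegreeOne (I : Ideal A) : I →ₗ[A] reesAlgebra I where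
  toFun y := ⟨monomial 1 (y : A), reesAlgebra.monomial_mem.mpr (by simp)⟩
  map_add' y z := Subtype.ext (by simp)
  map_smul' r y := Subtype.ext (by simp [smul_monomial])

open Polynomial in
theorem mem_span_reesDegreeOne_pow {A : Type*} [CommRing A] (I : Ideal A) (n : ℕ) :
    ∀ a ∈ I ^ n, ∃ f ∈ Ideal.span (Set.range (reesDegreeOne I)) ^ n,
      (f : A[X]) = monomial n a := by
  induction n with
  | zero =>
    intro a _
    exact ⟨algebraMap A _ a, by simp, rfl⟩
  | succ n ih =>
    intro a ha
    rw [pow_succ] at ha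
    refine Submodule.mul_induction_on ha (fun b hb y hy => ?_) fun a b ha hb => ?_
    · obtain ⟨f, hf, hfb⟩ := ih b hb
      refine ⟨f * reesDegreeOne I ⟨y, hy⟩, ?_, ?_⟩
      · rw [pow_succ]
        exact Ideal.mul_mem_mul hf (Ideal.subset_span ⟨_, rfl⟩)
      · rw [MulMemClass.coe_mul, hfb]
        exact monomial_mul_monomial n 1 b y
    · obtain ⟨f, hf, hfa⟩ := ha
      obtain ⟨g, hg, hgb⟩ := hb
      exact ⟨f + g, add_mem hf hg, by simp [hfa, hgb]⟩

open Polynomial in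
/-- The kernel of the map from the Rees algebra to the associated graded ring. -/
noncomputable def reesGradedKernel (I : Ideal A) : Ideal (reesAlgebra I) where
  carrier := {f | ∀ n, (f : A[X]).coeff n ∈ I ^ (n + 1)}
  zero_mem' n := by simp
  add_mem' hf hg n := by
    simpa using add_mem (hf n) (hg n)
  smul_mem' g f hf n := by
    rw [smul_eq_mul, MulMemClass.coe_mul, coeff_mul]
    refine sum_mem fun ij hij => ?_
    rw [← Finset.HasAntidiagonal.mem_antidiagonal.mp hij, add_assoc, pow_add]
    exact Ideal.mul_mem_mul (g.2 _) (hf _)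

-- Take a primary decomposition of the kernel of the map from the Rees algebra to the associated
-- graded ring. Components whose radical contains all of `𝔪 t` contain everything of high degree.
-- For the others, `x` is chosen with `x t` outside the radical, so `x t` can be cancelled.
open Polynomial in
theorem exists_superficial [Infinite (ResidueField A)] (E : Finset (Ideal A))
    (hE : ∀ p ∈ E, ¬ maximalIdeal A ≤ p) :
    ∃ x ∈ maximalIdeal A, (∀ p ∈ E, x ∉ p) ∧ ∃ c, ∀ n ≥ c, ∀ a ∈ maximalIdeal A ^ n,
      x * a ∈ maximalIdeal A ^ (n + 2) → a ∈ maximalIdeal A ^ (n + 1) := by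
  classical
  set m := maximalIdeal A with hm
  obtain ⟨t, ht, hprim⟩ := Submodule.isLasker (reesAlgebra m) (reesAlgebra m) (reesGradedKernel m)
  let V : Ideal (reesAlgebra m) → Submodule A m := fun Q =>
    (Q.radical.restrictScalars A).comap (reesDegreeOne m)
  obtain ⟨x, hx⟩ := exists_forall_notMem_of_infinite_residueField
    (((t.image V).filter (· ≠ ⊤)) ∪ E.image fun p => Submodule.comap m.subtype p) (by
      intro h
      rcases Finset.mem_union.mp h with h | h
      · simp at h
      · obtain ⟨p, hp, hpt⟩ := Finset.mem_image.mp h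
        exact hE p hp fun y hy => (hpt ▸ Submodule.mem_top :
          (⟨y, hy⟩ : m) ∈ Submodule.comap m.subtype p))
  have hirr : ∀ Q : Ideal (reesAlgebra m), ∃ c, V Q = ⊤ →
      Ideal.span (Set.range (reesDegreeOne m)) ^ c ≤ Q := by
    intro Q
    by_cases h : V Q = ⊤
    · obtain ⟨c, hc⟩ := Ideal.exists_pow_le_of_le_radical_of_fg
        (I := Ideal.span (Set.range (reesDegreeOne m))) (J := Q) (by
          refine Ideal.span_le.mpr ?_
          rintro _ ⟨y, rfl⟩
          exact (h ▸ Submodule.mem_top : y ∈ V Q)) (IsNoetherian.noetherian _)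
      exact ⟨c, fun _ => hc⟩
    · exact ⟨0, fun h' => absurd h' h⟩
  choose c hc using hirr
  refine ⟨x, x.2, fun p hp hxp => hx _ (Finset.mem_union_right _
    (Finset.mem_image_of_mem _ hp)) hxp, t.sup c, fun n hn a ha hxa => ?_⟩
  obtain ⟨f, hf, hfa⟩ := mem_span_reesDegreeOne_pow m n a ha
  have hprod : reesDegreeOne m x * f ∈ reesGradedKernel m := by
    intro k
    have : ((reesDegreeOne m x * f : reesAlgebra m) : A[X]) = monomial (1 + n) (x * a) := by
      rw [MulMemClass.coe_mul, hfa]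
      exact monomial_mul_monomial 1 n (x : A) a
    rw [this, coeff_monomial]
    split_ifs with hk
    · rw [← hk, add_comm 1 n]
      exact hxa
    · exact zero_mem _
  have hfmem : f ∈ reesGradedKernel m := by
    rw [← ht, Finset.inf_eq_iInf, Submodule.mem_iInf]
    refine fun Q => (Submodule.mem_iInf _).mpr fun hQ => ?_
    by_cases h : V Q = ⊤
    · exact hc Q h (Ideal.pow_le_pow_right ((Finset.le_sup hQ).trans hn) hf)
    · have hQk : reesGradedKernel m ≤ Q := ht ▸ Finset.inf_le hQ
      have h1 := hQk hprod
      rw [mul_comm] at h1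
      refine ((Ideal.isPrimary_iff.mp (hprim hQ)).2 h1).resolve_right fun h2 => ?_
      exact hx (V Q) (Finset.mem_union_left _ (Finset.mem_filter.mpr
        ⟨Finset.mem_image_of_mem _ hQ, h⟩)) h2
  have := hfmem n
  rwa [hfa, coeff_monomial, if_pos rfl] at this

/-- Artin–Rees and regularity of `x` first put `a` into `𝔪 ^ c`; superficiality then raises the
exponent one step at a time up to `n`. -/
theorem exists_forall_mul_mem_pow_succ {x : A} (hx : IsRegularMod ⊥ x)
    {c : ℕ} (hc : ∀ n ≥ c, ∀ a ∈ maximalIdeal A ^ n,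
      x * a ∈ maximalIdeal A ^ (n + 2) → a ∈ maximalIdeal A ^ (n + 1)) :
    ∃ n₀, ∀ n ≥ n₀, ∀ a, x * a ∈ maximalIdeal A ^ (n + 1) → a ∈ maximalIdeal A ^ n := by
  obtain ⟨k, hk⟩ := Ideal.exists_pow_inf_eq_pow_smul (maximalIdeal A) (Ideal.span {x})
  refine ⟨k + c, fun n hn a ha => ?_⟩
  have h0 : a ∈ maximalIdeal A ^ c := by
    have h1 : x * a ∈ maximalIdeal A ^ (n + 1) • (⊤ : Submodule A A) ⊓ Ideal.span {x} :=
      ⟨by simpa using ha, Ideal.mem_span_singleton'.mpr ⟨a, mul_comm _ _⟩⟩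
    rw [hk (n + 1) (by lia)] at h1
    have h2 : x * a ∈ maximalIdeal A ^ (n + 1 - k) * Ideal.span {x} :=
      (smul_mono_right _ inf_le_right :
        maximalIdeal A ^ (n + 1 - k) • (_ : Submodule A A) ≤ _ • Ideal.span {x}) h1
    obtain ⟨b, hb, hab⟩ := Ideal.mem_mul_span_singleton.mp h2
    have : a - b = 0 := hx _ (by
      rw [Ideal.mem_bot]
      linear_combination -hab)
    rw [sub_eq_zero.mp this]
    exact Ideal.pow_le_pow_right (by lia) hb
  have key : ∀ i, c + i ≤ n → a ∈ maximalIdeal A ^ (c + i) := by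
    intro i
    induction i with
    | zero => exact fun _ => h0
    | succ i ih =>
      intro hi
      exact hc (c + i) (by lia) a (ih (by lia)) (Ideal.pow_le_pow_right (by lia) ha)
  have := key (n - c) (by lia)
  rwa [Nat.add_sub_cancel' (by lia)] at this

end SuperficialElements

/-! ### Existence of parameter ideals. -/

section ParameterIdeals

variable {A : Type*} [CommRing A] [IsLocalRing A]

theorem exists_maximalIdeal_pow_le [IsNoetherianRing A] {I : Ideal A}
    (h : I.radical = maximalIdeal A) : ∃ k, maximalIdeal A ^ k ≤ I := by
  obtain ⟨k, hk⟩ := I.exists_radical_pow_le_of_fg (IsNoetherian.noetherian _)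
  exact ⟨k, h ▸ hk⟩

theorem radical_eq_maximalIdeal_of_forall {I : Ideal A} (hI : I ≠ ⊤)
    (h : ∀ p : Ideal A, p.IsPrime → I ≤ p → p = maximalIdeal A) :
    I.radical = maximalIdeal A := by
  rw [Ideal.radical_eq_sInf]
  refine le_antisymm (sInf_le ⟨le_maximalIdeal hI, inferInstance⟩) (le_sInf fun p hp => ?_)
  rw [h p hp.2 hp.1]

theorem exists_fin_range_eq_of_card_eq {α : Type*} (s : Finset α) {d : ℕ} (h : s.card = d) :
    ∃ x : Fin d → α, Set.range x = (s : Set α) := by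
  let e := s.equivFinOfCardEq h
  refine ⟨fun i => (e.symm i : α), ?_⟩
  ext a
  constructor
  · rintro ⟨i, rfl⟩
    exact (e.symm i).2
  · intro ha
    exact ⟨e ⟨a, ha⟩, by simp⟩

theorem exists_radical_span_range_eq [IsNoetherianRing A] {d : ℕ} (hd : ringKrullDim A = d) :
    ∃ x : Fin d → A, (Ideal.span (Set.range x)).radical = maximalIdeal A := by
  obtain ⟨s, hs, hcard⟩ := (maximalIdeal A).exists_finset_card_eq_height_of_isNoetherianRing
  have hsd : s.card = d := by
    rw [← maximalIdeal_height_eq_ringKrullDim, ← hcard] at hd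
    exact_mod_cast hd
  obtain ⟨x, hx⟩ := exists_fin_range_eq_of_card_eq s hsd
  refine ⟨x, hx ▸ radical_eq_maximalIdeal_of_forall ?_ fun p hp hsp => ?_⟩
  · intro h
    exact Ideal.IsPrime.ne_top inferInstance (top_le_iff.mp (h ▸ hs.1.2))
  · exact le_antisymm (le_maximalIdeal hp.ne_top) (hs.2 ⟨hp, hsp⟩ (le_maximalIdeal hp.ne_top))

end ParameterIdeals

/-! ### Dimension and length along finite extensions. -/

section IntegralExtensions

theorem ringKrullDim_eq_of_isIntegral_of_injective {S A : Type*} [CommRing S] [CommRing A]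
    [Algebra S A] [Algebra.IsIntegral S A] (h : Function.Injective (algebraMap S A)) :
    ringKrullDim S = ringKrullDim A := by
  refine le_antisymm (iSup_le fun l => ?_) ?_
  · obtain ⟨P, -, hP, hPl⟩ := Ideal.exists_ideal_over_prime_of_isIntegral l.head.asIdeal
      (⊥ : Ideal A) (by
        rw [← RingHom.ker_eq_comap_bot, (RingHom.injective_iff_ker_eq_bot _).mp h]
        exact bot_le)
    have : P.LiesOver l.head.asIdeal := ⟨hPl.symm⟩
    obtain ⟨L, hL, -⟩ := Ideal.exists_ltSeries_of_hasGoingUp l P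
    rw [← hL]
    exact Order.LTSeries.length_le_krullDim L
  · refine Order.krullDim_le_of_strictMono (PrimeSpectrum.comap (algebraMap S A)) ?_
    intro p q hpq
    exact Ideal.IsIntegral.comap_lt_comap hpq

theorem Module.length_quotient_smul_top_le {S M : Type*} [CommRing S] [IsLocalRing S]
    [AddCommGroup M] [Module S M] [Module.Finite S M] :
    Module.length S (M ⧸ (maximalIdeal S • ⊤ : Submodule S M)) ≤
      ((⊤ : Submodule S M).spanFinrank : ℕ∞) := by
  classical
  obtain ⟨s, hs, hspan⟩ :=
    (Module.Finite.fg_top : (⊤ : Submodule S M).FG).exists_span_finset_card_eq_spanFinrank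
  set Q := M ⧸ (maximalIdeal S • ⊤ : Submodule S M)
  let ψ : (s → S ⧸ maximalIdeal S) →ₗ[S] Q := LinearMap.lsum S (fun _ => S ⧸ maximalIdeal S) S
    fun v => Submodule.liftQ (maximalIdeal S)
      (LinearMap.toSpanSingleton S Q (Submodule.Quotient.mk (v : M))) fun r hr => by
        rw [LinearMap.mem_ker, LinearMap.toSpanSingleton_apply, ← Submodule.Quotient.mk_smul,
          Submodule.Quotient.mk_eq_zero]
        exact Submodule.smul_mem_smul hr Submodule.mem_top
  have hψ : Function.Surjective ψ := by
    have htop : (Submodule.span S (s : Set M)).map (maximalIdeal S • ⊤ : Submodule S M).mkQ = ⊤ := by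
      rw [hspan, Submodule.map_top, Submodule.range_mkQ]
    rw [← LinearMap.range_eq_top, ← top_le_iff, ← htop, Submodule.map_span, Submodule.span_le]
    rintro _ ⟨v, hv, rfl⟩
    refine ⟨Pi.single ⟨v, hv⟩ (Submodule.Quotient.mk 1), ?_⟩
    rw [LinearMap.lsum_piSingle]
    exact one_smul S ((maximalIdeal S • ⊤ : Submodule S M).mkQ v)
  refine (Module.length_le_of_surjective ψ hψ).trans ?_
  have : IsSimpleModule S (S ⧸ maximalIdeal S) :=
    isSimpleModule_iff_isCoatom.mpr (maximalIdeal.isMaximal S).out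
  rw [Module.length_pi_of_fintype]
  simp [Module.length_eq_one, hs]

theorem Module.length_le_length_of_tower (S A M : Type*) [Ring S] [Ring A] [SMul S A]
    [AddCommGroup M] [Module S M] [Module A M] [IsScalarTower S A M] :
    Module.length A M ≤ Module.length S M := by
  rw [← WithBot.coe_le_coe, Module.coe_length, Module.coe_length]
  exact Order.krullDim_le_of_orderEmbedding (Submodule.restrictScalarsEmbedding S A M)

end IntegralExtensions

/-! ### Comparison with the Noether normalization degree. -/

section NoetherNormalizationDegree

variable {A : Type*} [CommRing A] [IsLocalRing A]

/-- Integrality makes `S` local, of the same dimension as `A`. Generators of `𝔪_S`, as many as this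
dimension by regularity, therefore generate a parameter ideal of `A`. -/
theorem parameterDegree_le_spanFinrank {S : Type*} [CommRing S] [Algebra S A]
    (h : Function.Injective (algebraMap S A)) [IsRegularRing S] [Module.Finite S A] :
    parameterDegree A ≤ ((⊤ : Submodule S A).spanFinrank : ℕ∞) := by
  have hlocal : IsLocalHom (algebraMap S A) := 
    (algebraMap_isIntegral_iff.mpr inferInstance : (algebraMap S A).IsIntegral).isLocalHom h
  have : IsLocalRing S := (algebraMap S A).domain_isLocalRing
  have : IsRegularLocalRing S := IsRegularLocalRing.of_isRegularRing_of_isLocalRing S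
  obtain ⟨s, hs, hspan⟩ :=
    (IsNoetherian.noetherian (maximalIdeal S)).exists_span_finset_card_eq_spanFinrank
  obtain ⟨x, hx⟩ := exists_fin_range_eq_of_card_eq s hs
  have hdim : ringKrullDim A = ((maximalIdeal S).spanFinrank : WithBot ℕ∞) := by
    rw [← ringKrullDim_eq_of_isIntegral_of_injective h,
      IsRegularLocalRing.spanFinrank_maximalIdeal]
  set I := (maximalIdeal S).map (algebraMap S A) with hI
  have hIspan : I = Ideal.span (Set.range fun i => algebraMap S A (x i)) := by
    have hmx : maximalIdeal S = Ideal.span (Set.range x) := by rw [hx]; exact hspan.symm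
    have hmap := congrArg (Ideal.map (algebraMap S A)) hmx
    rw [Ideal.map_span, ← Set.range_comp] at hmap
    exact hmap
  have hIm : I ≤ maximalIdeal A := ((local_hom_TFAE (algebraMap S A)).out 0 2).mp hlocal
  have hpar : IsParameterIdeal I := by
    refine ⟨_, hdim, _, hIspan, radical_eq_maximalIdeal_of_forall
      (fun h => Ideal.IsPrime.ne_top inferInstance (top_le_iff.mp (h ▸ hIm))) fun p hp hIp => ?_⟩
    have hcomap : p.comap (algebraMap S A) = maximalIdeal S :=
      ((maximalIdeal.isMaximal S).eq_of_le (Ideal.comap_ne_top _ hp.ne_top)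
        (Ideal.map_le_iff_le_comap.mp hIp)).symm
    exact eq_maximalIdeal (Ideal.isMaximal_of_isIntegral_of_isMaximal_comap p
      (hcomap ▸ maximalIdeal.isMaximal S))
  refine (iInf₂_le I hpar).trans ((Module.length_le_length_of_tower S A (A ⧸ I)).trans ?_)
  have he : (maximalIdeal S • ⊤ : Submodule S A) = I.restrictScalars S := by
    rw [hI, Ideal.smul_top_eq_map]
  have hlen := Module.length_quotient_smul_top_le (S := S) (M := A)
  rw [he] at hlen
  exact hlen

theorem parameterDegree_le_noetherNormalizationDegree :
    parameterDegree A ≤ noetherNormalizationDegree A :=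
  le_iInf fun S => le_iInf₂ fun _ _ => parameterDegree_le_spanFinrank (S := S) Subtype.val_injective

end NoetherNormalizationDegree

/-! ### Multiplicity against colength of parameter ideals. -/

section HilbertSamuel

/-- The Hilbert–Samuel function of a local ring. -/
noncomputable def hilbertSamuel (A : Type*) [CommRing A] [IsLocalRing A] (n : ℕ) : ℤ :=
  (maximalIdeal A ^ n).colength

theorem tendsto_hilbertSamuel {A : Type*} [CommRing A] [IsLocalRing A] {d e : ℕ}
    (h : ∀ᶠ n in atTop, (fwdDiff 1)^[d] (hilbertSamuel A) n = e) :
    Tendsto (fun n : ℕ => ((d.factorial : ℝ) * ((maximalIdeal A ^ n).colength : ℝ)) / (n : ℝ) ^ d)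
      atTop (𝓝 (e : ℝ)) := by
  simpa [hilbertSamuel] using tendsto_of_eventually_fwdDiff_eq h

variable {A : Type*} [CommRing A] [IsLocalRing A] [IsNoetherianRing A]

theorem colength_maximalIdeal_pow_le {I : Ideal A} (hI : I.radical = maximalIdeal A) (n : ℕ) :
    (maximalIdeal A ^ n).colength ≤ (I ^ n).colength := by
  obtain ⟨k, hk⟩ := exists_maximalIdeal_pow_le hI
  refine colength_anti (n := k * n) ?_ (Ideal.pow_right_mono (hI ▸ Ideal.le_radical) n)
  rw [pow_mul]
  exact Ideal.pow_right_mono hk n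

theorem exists_eventually_fwdDiff_hilbertSamuel_eq {d : ℕ} (hd : ringKrullDim A = d) :
    ∃ e : ℕ, ∀ᶠ n in atTop, (fwdDiff 1)^[d] (hilbertSamuel A) n = e := by
  obtain ⟨x, hx⟩ := exists_radical_span_range_eq hd
  obtain ⟨k, hk⟩ := exists_maximalIdeal_pow_le hx
  obtain ⟨r, hr⟩ := exists_fwdDiffEventuallyZero_colength_pow A
  refine exists_eventually_fwdDiff_eq (C := (Ideal.span (Set.range x)).colength * 2)
    (fun n => Int.natCast_nonneg _) ?_ hr
  filter_upwards [(tendsto_card_exponentsDegreeLT d).eventually_le_const one_lt_two,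
    eventually_gt_atTop 0] with n hn hn0
  have hn' : (0 : ℝ) < n := by exact_mod_cast hn0
  rw [div_le_iff₀ (by positivity)] at hn
  have h1 : ((exponentsDegreeLT d n).card : ℝ) ≤ 2 * (n : ℝ) ^ d := by
    refine le_trans (le_mul_of_one_le_left (by positivity) ?_) hn
    exact_mod_cast Nat.factorial_pos d
  have h2 : ((maximalIdeal A ^ n).colength : ℝ) ≤
      (Ideal.span (Set.range x)).colength * (exponentsDegreeLT d n).card := by
    exact_mod_cast (colength_maximalIdeal_pow_le hx n).trans (colength_pow_le x hk n)
  rw [hilbertSamuel, Int.cast_natCast, mul_assoc]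
  exact h2.trans (mul_le_mul_of_nonneg_left h1 (by positivity))

theorem multiplicity_le_colength {d e : ℕ}
    (he : ∀ᶠ n in atTop, (fwdDiff 1)^[d] (hilbertSamuel A) n = e) {x : Fin d → A}
    (hx : (Ideal.span (Set.range x)).radical = maximalIdeal A) :
    e ≤ (Ideal.span (Set.range x)).colength := by
  obtain ⟨k, hk⟩ := exists_maximalIdeal_pow_le hx
  have h1 := (tendsto_card_exponentsDegreeLT d).const_mul
    ((Ideal.span (Set.range x)).colength : ℝ)
  have h2 : (e : ℝ) ≤ (Ideal.span (Set.range x)).colength * 1 := by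
    refine le_of_tendsto_of_tendsto' (tendsto_hilbertSamuel he) h1 fun n => ?_
    have h : ((maximalIdeal A ^ n).colength : ℝ) ≤
        (Ideal.span (Set.range x)).colength * (exponentsDegreeLT d n).card := by
      exact_mod_cast (colength_maximalIdeal_pow_le hx n).trans (colength_pow_le x hk n)
    rw [← mul_div_assoc, mul_left_comm]
    gcongr
  rw [mul_one] at h2
  exact_mod_cast h2

/-- Translation by the fixed degree of `α` does not change leading growth, so one defect costs a
full unit in the limit. -/
theorem multiplicity_add_one_le_colength {d e : ℕ}
    (he : ∀ᶠ n in atTop, (fwdDiff 1)^[d] (hilbertSamuel A) n = e) {x : Fin d → A}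
    (hx : (Ideal.span (Set.range x)).radical = maximalIdeal A) {α : LexExponent d} {c : A}
    (hcI : c ∉ Ideal.span (Set.range x)) (hc : c * lexMonomial x α ∈ lexIdealGT x α) :
    e + 1 ≤ (Ideal.span (Set.range x)).colength := by
  obtain ⟨k, hk⟩ := exists_maximalIdeal_pow_le hx
  have h1 := (tendsto_card_exponentsDegreeLT d).const_mul
    ((Ideal.span (Set.range x)).colength : ℝ)
  have h2 : (e : ℝ) + 1 ≤ (Ideal.span (Set.range x)).colength * 1 := by
    refine le_of_tendsto_of_tendsto' ((tendsto_hilbertSamuel he).add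
      (tendsto_card_exponentsDegreeLT_sub d α.degree)) h1 fun n => ?_
    have h : ((maximalIdeal A ^ n).colength : ℝ) + (exponentsDegreeLT d (n - α.degree)).card ≤
        (Ideal.span (Set.range x)).colength * (exponentsDegreeLT d n).card := by
      exact_mod_cast (Nat.add_le_add_right (colength_maximalIdeal_pow_le hx n) _).trans
        (colength_pow_add_card_le x hk hcI hc n)
    rw [← mul_div_assoc, mul_left_comm, ← add_div, ← mul_add]
    gcongr
  rw [mul_one] at h2
  exact_mod_cast h2

theorem isCohenMacaulayLocalRing_of_colength_le {d e : ℕ} (hd : ringKrullDim A = d)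
    (he : ∀ᶠ n in atTop, (fwdDiff 1)^[d] (hilbertSamuel A) n = e) {x : Fin d → A}
    (hx : (Ideal.span (Set.range x)).radical = maximalIdeal A)
    (hle : (Ideal.span (Set.range x)).colength ≤ e) : IsCohenMacaulayLocalRing A := by
  have hm : ∀ i, x i ∈ maximalIdeal A := fun i =>
    hx ▸ Ideal.le_radical (Ideal.subset_span (Set.mem_range_self i))
  have hreg : RingTheory.Sequence.IsRegular A (List.ofFn x) := by
    refine isRegular_ofFn x hm (mem_span_Iio_of_mul_mem x hm fun α c hc => ?_)
    by_contra hcI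
    have := multiplicity_add_one_le_colength he hx hcI hc
    lia
  -- Depth never exceeds dimension, since each term of a regular sequence lowers the dimension by
  -- one; `x` attains the bound.
  have hdepth : localDepth A = d := by
    refine le_antisymm (iSup₂_le fun rs hrs => ?_) ?_
    · have h := ringKrullDim_add_length_eq_ringKrullDim_of_isRegular rs hrs
      have hnt : Nontrivial (A ⧸ Ideal.ofList rs) := by
        refine Ideal.Quotient.nontrivial_iff.mpr fun htop => hrs.top_ne_smul ?_
        simp [htop]
      have h0 : (0 : WithBot ℕ∞) ≤ ringKrullDim (A ⧸ Ideal.ofList rs) := ringKrullDim_nonneg_of_nontrivial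
      have h1 : ((rs.length : ℕ∞) : WithBot ℕ∞) ≤ ((d : ℕ∞) : WithBot ℕ∞) := by
        have h2 := add_le_add_left h0 (rs.length : WithBot ℕ∞)
        rw [zero_add, h, hd] at h2
        exact_mod_cast h2
      exact WithBot.coe_le_coe.mp h1
    · refine le_trans ?_ (le_iSup₂ (f := fun (rs : List A)
        (_ : RingTheory.Sequence.IsRegular A rs) => (rs.length : ℕ∞)) (List.ofFn x) hreg)
      simp
  rw [IsCohenMacaulayLocalRing, hdepth, hd]
  rfl

end HilbertSamuel

theorem IsCohenMacaulayLocalRing.hasDepthGE {A : Type*} [CommRing A] [IsLocalRing A]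
    {d : ℕ} (hd : ringKrullDim A = d) (h : IsCohenMacaulayLocalRing A) : HasDepthGE d (⊥ : Ideal A) := by
  have hdepth : localDepth A = d := by
    rw [IsCohenMacaulayLocalRing, hd] at h
    exact WithBot.coe_injective h
  rcases d with _ | d
  · trivial
  have hlt : (d : ℕ∞) < localDepth A := by
    rw [hdepth]
    exact_mod_cast Nat.lt_succ_self d
  obtain ⟨rs, hrs⟩ := lt_iSup_iff.mp hlt
  obtain ⟨hreg, hrs⟩ := lt_iSup_iff.mp hrs
  have hle : (rs.length : ℕ∞) ≤ localDepth A := le_iSup₂ (f := fun (rs : List A)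
    (_ : RingTheory.Sequence.IsRegular A rs) => (rs.length : ℕ∞)) rs hreg
  rw [hdepth] at hle
  have h1 : d < rs.length := by exact_mod_cast hrs
  have h2 : rs.length ≤ d + 1 := by exact_mod_cast hle
  have h3 := hasDepthGE_of_isRegular hreg
  rwa [show rs.length = d + 1 by lia] at h3

/-! ### Passage to quotients. -/

section Surjections

variable {A B : Type*} [CommRing A] [CommRing B]

theorem length_quotient_comap_eq {f : A →+* B} (hf : Function.Surjective f) (J : Ideal B) :
    Module.length A (A ⧸ J.comap f) = Module.length B (B ⧸ J) := by
  algebraize [f]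
  rw [← Module.length_eq_of_surjective (S := A) (R := B) (M := B ⧸ J) hf]
  let g : A →ₗ[A] (B ⧸ J) := Algebra.linearMap A (B ⧸ J)
  have hg : Function.Surjective g := Ideal.Quotient.mk_surjective.comp hf
  have hk : LinearMap.ker g = J.comap f := by
    ext a
    exact Ideal.Quotient.eq_zero_iff_mem
  rw [← hk]
  exact (g.quotKerEquivOfSurjective hg).length_eq

variable [IsLocalRing A] [IsLocalRing B]

/-- Lifts of parameters of `B`, together with `x`, generate the full preimage of the parameter
ideal, which has the same colength. -/
theorem parameterDegree_le_of_surjective {f : A →+* B} (hf : Function.Surjective f) {x : A}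
    (hx : RingHom.ker f = Ideal.span {x}) {d : ℕ} (hA : ringKrullDim A = (d + 1 : ℕ))
    (hB : ringKrullDim B = d) : parameterDegree A ≤ parameterDegree B := by
  have := hf.isLocalHom
  refine le_iInf₂ fun J hJ => ?_
  obtain ⟨d', hd', y, rfl, hrad⟩ := hJ
  obtain rfl : d = d' := by
    rw [hB] at hd'
    exact_mod_cast hd'
  choose z hz using fun i => hf (y i)
  refine (iInf₂_le _ ?_).trans (length_quotient_comap_eq hf _).le
  refine ⟨d + 1, hA, Fin.cons x z, ?_, ?_⟩
  · have hy : Ideal.span (Set.range y) = (Ideal.span (Set.range z)).map f := by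
      rw [Ideal.map_span, ← Set.range_comp]
      exact congrArg (fun w => Ideal.span (Set.range w)) (funext fun i => (hz i).symm)
    rw [hy, Ideal.comap_map_of_surjective f hf, ← RingHom.ker_eq_comap_bot, hx, Fin.range_cons,
      Ideal.span_insert, sup_comm]
  · rw [← Ideal.comap_radical, hrad, maximalIdeal_comap]

theorem comap_maximalIdeal_pow {f : A →+* B} (hf : Function.Surjective f) (n : ℕ) :
    (maximalIdeal B ^ n).comap f = maximalIdeal A ^ n ⊔ RingHom.ker f := by
  have := hf.isLocalHom
  have h : maximalIdeal B = (maximalIdeal A).map f := by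
    rw [← maximalIdeal_comap f, Ideal.map_comap_of_surjective f hf]
  rw [h, ← Ideal.map_pow, Ideal.comap_map_of_surjective f hf, RingHom.ker_eq_comap_bot]

theorem infinite_residueField_of_isLocalHom (f : A →+* B) [IsLocalHom f]
    [Infinite (ResidueField A)] : Infinite (ResidueField B) :=
  Infinite.of_injective (ResidueField.map f) (ResidueField.map f).injective

end Surjections

/-! ### Cohen–Macaulay rings attain the multiplicity. -/

section CohenMacaulay

theorem fwdDiff_iter_succ_eq_of_forall_ge {f g : ℕ → ℤ} {N : ℕ}
    (h : ∀ n ≥ N, f (n + 1) - f n = g (n + 1)) (d : ℕ) :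
    ∀ n ≥ N, (fwdDiff 1)^[d + 1] f n = (fwdDiff 1)^[d] g (n + 1) := by
  induction d with
  | zero => exact h
  | succ d ih =>
    intro n hn
    rw [Function.iterate_succ_apply', fwdDiff, ih n hn, ih (n + 1) (by lia),
      Function.iterate_succ_apply' (fwdDiff 1) d, fwdDiff]

theorem parameterDegree_le_of_hasDepthGE (d : ℕ) : ∀ (A : Type*) [CommRing A] [IsLocalRing A]
    [IsNoetherianRing A] [Infinite (ResidueField A)], ringKrullDim A = d →
    HasDepthGE d (⊥ : Ideal A) → ∀ e : ℕ,
    (∀ᶠ n in atTop, (fwdDiff 1)^[d] (hilbertSamuel A) n = e) → parameterDegree A ≤ e := by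
  induction d with
  | zero =>
    intro A _ _ _ _ hd _ e he
    obtain ⟨x, hx⟩ := exists_radical_span_range_eq hd
    obtain ⟨k, hk⟩ := exists_maximalIdeal_pow_le hx
    obtain ⟨n, hn, hkn⟩ := (he.and (eventually_ge_atTop k)).exists
    refine (iInf₂_le (Ideal.span (Set.range x)) ⟨0, hd, x, rfl, hx⟩).trans ?_
    rw [← coe_colength hk]
    have h1 : maximalIdeal A ^ n ≤ Ideal.span (Set.range x) :=
      (Ideal.pow_le_pow_right hkn).trans hk
    -- In dimension zero the family of parameters is empty, and `𝔪 ^ n = 0` for large `n`, so `e` is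
    -- the length of `A`.
    have h2 : Ideal.span (Set.range x) = ⊥ := by simp
    have h3 : maximalIdeal A ^ n = Ideal.span (Set.range x) := by
      rw [h2] at h1 ⊢
      exact le_bot_iff.mp h1
    have h4 : ((maximalIdeal A ^ n).colength : ℤ) = e := hn
    rw [← h3]
    exact_mod_cast h4.le
  | succ d ih =>
    intro A _ _ _ _ hd hdep e he
    obtain ⟨y, hym, hy, -⟩ := id hdep
    have hsoc := hy.hasTrivialSocle hym
    obtain ⟨x, hxm, hxE, c, hc⟩ := exists_superficial
      (associatedPrimes.finite A (A ⧸ (⊥ : Ideal A))).toFinset fun p hp =>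
        hsoc.not_le_of_mem_associatedPrimes (by simpa using hp)
    have hx : IsRegularMod ⊥ x := isRegularMod_iff_notMem_associatedPrimes.mpr fun p hp =>
      hxE p (by simpa using hp)
    obtain ⟨n₀, hn₀⟩ := exists_forall_mul_mem_pow_succ hx hc
    let f := Ideal.Quotient.mk (Ideal.span {x})
    have hf : Function.Surjective f := Ideal.Quotient.mk_surjective
    have hker : RingHom.ker f = Ideal.span {x} := Ideal.mk_ker
    have hne : Ideal.span {x} ≠ ⊤ := fun h => Ideal.IsPrime.ne_top (I := maximalIdeal A)
      inferInstance (top_le_iff.mp (h ▸ (Ideal.span_singleton_le_iff_mem _).mpr hxm))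
    have : Nontrivial (A ⧸ Ideal.span {x}) := Ideal.Quotient.nontrivial_iff.mpr hne
    have : IsLocalRing (A ⧸ Ideal.span {x}) := IsLocalRing.of_surjective' f hf
    have := hf.isLocalHom
    have := infinite_residueField_of_isLocalHom f
    have hxs : IsSMulRegular A x := fun a b hab => by
      have := hx (a - b) (by
        rw [Ideal.mem_bot, mul_sub, sub_eq_zero]
        exact hab)
      exact sub_eq_zero.mp this
    have hdB : ringKrullDim (A ⧸ Ideal.span {x}) = d := by
      have h := ringKrullDim_quotient_span_singleton_succ_eq_ringKrullDim hxs hxm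
      rw [hd] at h
      have hfin : ringKrullDim (A ⧸ Ideal.span {x}) + 1 = (d : WithBot ℕ∞) + 1 := by
        rw [h]
        norm_cast
      exact (ENat.WithBot.add_one_cancel).mp hfin
    have hdepB : HasDepthGE d (⊥ : Ideal (A ⧸ Ideal.span {x})) := by
      refine HasDepthGE.of_comap hf ?_
      rw [← RingHom.ker_eq_comap_bot, hker, ← bot_sup_eq (Ideal.span {x})]
      exact hdep.sup_span hxm hx
    obtain ⟨e', he'⟩ := exists_eventually_fwdDiff_hilbertSamuel_eq hdB
    -- As `(𝔪 ^ (n + 1) : x) = 𝔪 ^ n`, multiplication by `x` embeds `A / 𝔪 ^ n` into `A / 𝔪 ^ (n +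
    -- 1)` with the quotient of `A / (x)` as cokernel.
    have hstep : ∀ n ≥ n₀, hilbertSamuel A (n + 1) - hilbertSamuel A n =
        hilbertSamuel (A ⧸ Ideal.span {x}) (n + 1) := by
      intro n hn
      have h1 := colength_eq_add_colength_comap x (le_refl (maximalIdeal A ^ (n + 1)))
      have h2 : Submodule.comap (LinearMap.mulLeft A x) (maximalIdeal A ^ (n + 1)) =
          maximalIdeal A ^ n := by
        refine le_antisymm (hn₀ n hn) fun a ha => ?_
        rw [Submodule.mem_comap, LinearMap.mulLeft_apply, pow_succ']
        exact Ideal.mul_mem_mul hxm ha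
      have h3 : (maximalIdeal (A ⧸ Ideal.span {x}) ^ (n + 1)).colength =
          (maximalIdeal A ^ (n + 1) ⊔ Ideal.span {x}).colength := by
        rw [Ideal.colength, ← length_quotient_comap_eq hf, comap_maximalIdeal_pow hf, hker]
        rfl
      rw [h2] at h1
      simp only [hilbertSamuel, h3, h1]
      push_cast
      ring
    have hee : e = e' := by
      obtain ⟨n, h1, h2, h3⟩ := (he.and (((tendsto_add_atTop_nat 1).eventually he').and
        (eventually_ge_atTop n₀))).exists
      rw [fwdDiff_iter_succ_eq_of_forall_ge hstep d n h3, h2] at h1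
      exact_mod_cast h1.symm
    rw [hee]
    exact (parameterDegree_le_of_surjective hf hker hd hdB).trans (ih _ hdB hdepB e' he')

end CohenMacaulay

theorem corollary4p5 (A : Type*) [CommRing A] [IsLocalRing A] [IsNoetherianRing A] :
    ∃ e : ℕ, IsLocalMultiplicity A e ∧
      (e : ℕ∞) ≤ parameterDegree A ∧
      parameterDegree A ≤ noetherNormalizationDegree A ∧
      (IsAdicComplete (maximalIdeal A) A →
        ((e : ℕ∞) = parameterDegree A → IsCohenMacaulayLocalRing A) ∧
        (Infinite (ResidueField A) →
          ((e : ℕ∞) = parameterDegree A ↔ IsCohenMacaulayLocalRing A))) := by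
  obtain ⟨d, hd⟩ : ∃ d : ℕ, ringKrullDim A = d := by
    rw [← maximalIdeal_height_eq_ringKrullDim]
    obtain ⟨d, hd⟩ := ENat.ne_top_iff_exists.mp
      (Ideal.height_ne_top (I := maximalIdeal A) (Ideal.IsPrime.ne_top inferInstance))
    exact ⟨d, by rw [← hd]; rfl⟩
  obtain ⟨e, he⟩ := exists_eventually_fwdDiff_hilbertSamuel_eq hd
  have hle : (e : ℕ∞) ≤ parameterDegree A := by
    refine le_iInf₂ fun I hI => ?_
    obtain ⟨d', hd', x, rfl, hx⟩ := hI
    obtain rfl : d = d' := by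
      rw [hd] at hd'
      exact_mod_cast hd'
    obtain ⟨k, hk⟩ := exists_maximalIdeal_pow_le hx
    rw [← coe_colength hk]
    exact_mod_cast multiplicity_le_colength he hx
  have hcm : (e : ℕ∞) = parameterDegree A → IsCohenMacaulayLocalRing A := by
    intro h
    -- An infimum below `e + 1` yields an actual parameter ideal of colength at most `e`.
    have hlt : parameterDegree A < (e : ℕ∞) + 1 := by
      rw [← h]
      exact_mod_cast Nat.lt_succ_self e
    obtain ⟨I, hI⟩ := iInf_lt_iff.mp hlt
    obtain ⟨⟨d', hd', x, rfl, hx⟩, hI⟩ := iInf_lt_iff.mp hI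
    obtain rfl : d = d' := by
      rw [hd] at hd'
      exact_mod_cast hd'
    obtain ⟨k, hk⟩ := exists_maximalIdeal_pow_le hx
    rw [← coe_colength hk] at hI
    refine isCohenMacaulayLocalRing_of_colength_le hd he hx (Nat.lt_succ_iff.mp ?_)
    exact_mod_cast hI
  exact ⟨e, ⟨d, hd, tendsto_hilbertSamuel he⟩, hle, parameterDegree_le_noetherNormalizationDegree,
    fun _ => ⟨hcm, fun _ => ⟨hcm, fun h => hle.antisymm
      (parameterDegree_le_of_hasDepthGE d A hd (h.hasDepthGE hd) e he)⟩⟩⟩
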